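/- **Setting.** Let $n\ge 1$, $A\ge 1$. For $\theta=(\theta_0,\dots,\theta_{n-1})$ let $T(\theta)$ be the matrix with entries $\theta_{|i-j|}$. A symmetric matrix is Robinson if each of its rows is unimodal with respect to its diagonal index. For a permutation $\Pi\in\mathcal S_n$ (identified with its matrix) put $\Pi\cdot M=\Pi M\Pi^\top$, and let $\tau$ be the reversal of $[n]$. We observe $Y=X+E$ with $X=\Pi^*\cdot T(\theta)$, where $\Pi^*\in\mathcal S_n$ and $\theta\in[0,A]^n$ is nonincreasing, and where the entries of $E$ are independent, centered and subgaussian: $\mathbb E e^{sE_{ij}}\le e^{s^2/2}$ for all $s\in\mathbb R$. For a set $\mathcal T'_n$ of Robinson and Toeplitz matrices and $\mathcal S'_n\subset\mathcal S_n$ let $$\rho^*(\mathcal T_n',\mathcal S_n')=\inf\{\|\Pi_1\cdot\Theta-\Pi_2\cdot\Theta\|_F:\ \Theta\in\mathcal T_n',\ \Pi_1,\Pi_2\in\mathcal S_n',\ \Pi_1^{-1}\Pi_2\notin\{\mathrm{Id},\tau\}\}\qquad(\inf\emptyset=\infty),$$ and let $r_n=A\sqrt n+\sqrt A\,n^{3/4}\log^{1/4}(n)$.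 **Procedure PINES**, with numeric constants $c_1,c_2>0$. *Distances.* Let $S_i=\sum_jY_{ij}$, $N_i=\{j\ne i: |S_j-S_i|\le c_1(A+\sqrt{n\log n})\}$, $U_i=\max_{j\in N_i}\langle Y_i,Y_j\rangle$ (and $0$ if $N_i=\emptyset$), $\hat d(i,i)=0$ and, for $i\neq j$, $\hat d(i,j)=\sqrt{\max(0,\,U_i+U_j-2\langle Y_i,Y_j\rangle)}$. *Radii.* With $\alpha=\sqrt2$, $\delta_0=\sqrt2A$, $\varepsilon=c_2(A+\sqrt A(n\log n)^{1/4})$ put $\rho_3=\delta_0+\varepsilon$, $\rho_2=\alpha\delta_0+2(1+\alpha)\varepsilon$, $\rho_1=\alpha^2\delta_0+(2\alpha^2+3\alpha+2)\varepsilon$. *Packing.* Start with $D=\emptyset$; while $D\ne[n]$, take any $i\notin D$, add it to $\mathcal P$, let $P_i=\{j\notin D:\hat d(i,j)\le\rho_1\}$ and replace $D$ by $D\cup P_i$. *Classes.* For $i\in\mathcal P$ let $G_i$ be the graph on $\{j:\hat d(i,j)>\rho_2\}$ in which $j,k$ are adjacent if $\hat d(j,k)\le\rho_3$, and let $\mathcal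 C_i$ be the set of classes of $\mathcal P\setminus\{i\}$ under connectedness in $G_i$. *Ordering.* Start with any $i\in\mathcal P$ such that $|\mathcal C_i|\le1$ and $Q=\{i\}$; while $Q\neq\mathcal P$, append to $Q$ any $i\in\mathcal P\setminus Q$ with $Q\in\mathcal C_i$. List the cells $P_i$ in the order found, each in any internal order; $\hat\Pi$ maps each element of $[n]$ to its position in this list. If a required $i$ does not exist, $\hat\Pi$ is an arbitrary permutation. **Theorem.** There are numeric constants $c_1,c_2,C>0$ such that PINES runs in a number of elementary operations (real RAM model) bounded by a polynomial in $n$, on every input and for all its arbitrary choices, and such that for all $n,A,\theta,\Pi^*$ and $E$ as above and all $\delta>0$: 1. with probability at least $1-\delta$, for all arbitrary choices in PINES, $\|\hat\Pi\cdot X-T(\theta)\|_F<\frac C\delta\, r_n$; 2. for every set $\mathcal T_n'$ of Robinson and Toeplitz matrices with $\rho^*(\mathcal T_n',\mathcal S_n)\ge\frac C\delta\, r_n$: if $T(\theta)\in\mathcal T_n'$, then with probability at least $1-\delta$, for all arbitrary choices in PINES, recovery is perfect, that is, $\hat\Pi\cdot X=T(\theta)$ and $\hat\Pi\,\Pi^*\in\{\mathrm{Id},\tau\}$.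 -/

import Mathlib

open MeasureTheory ProbabilityTheory
open scoped ENNReal NNReal

/-! ## Robinson and Toeplitz matrices, permutations acting on matrices -/

/-- A symmetric matrix whose rows are unimodal with respect to their diagonal index. -/
def IsRobinson {n : ℕ} (M : Matrix (Fin n) (Fin n) ℝ) : Prop :=
  M.IsSymm ∧
    (∀ i j k : Fin n, j ≤ k → k ≤ i → M i j ≤ M i k) ∧
    (∀ i j k : Fin n, i ≤ j → j ≤ k → M i k ≤ M i j)

/-- The symmetric Toeplitz matrix `T(θ)`, with entries `θ_{|i-j|}`. -/
def toeplitz {n : ℕ} (θ : Fin n → ℝ) : Matrix (Fin n) (Fin n) ℝ :=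
  Matrix.of fun i j => θ ⟨((i : ℤ) - (j : ℤ)).natAbs, by omega⟩

/-- The set of Robinson and Toeplitz matrices of size `n`. -/
def robinsonToeplitz (n : ℕ) : Set (Matrix (Fin n) (Fin n) ℝ) :=
  {M | IsRobinson M ∧ ∃ θ : Fin n → ℝ, M = toeplitz θ}

/-- The action `Π · M = Π M Πᵀ`, where `Π` is identified with the permutation matrix sending
the basis vector `e_j` to `e_{Π(j)}`: the entry `(i, j)` of `Π · M` is
`M (Π⁻¹ i) (Π⁻¹ j)`. -/
def permAct {n : ℕ} (p : Equiv.Perm (Fin n)) (M : Matrix (Fin n) (Fin n) ℝ) :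
    Matrix (Fin n) (Fin n) ℝ :=
  M.submatrix p.symm p.symm

theorem permAct_eq_mul {n : ℕ} (p : Equiv.Perm (Fin n)) (M : Matrix (Fin n) (Fin n) ℝ) :
    permAct p M =
      (Matrix.of fun i j => if i = p j then (1 : ℝ) else 0) * M *
        (Matrix.of fun i j => if i = p j then (1 : ℝ) else 0).transpose := by
  ext i j
  have h : ∀ a b : Fin n, (a = p b) = (b = p.symm a) := fun a b =>
    propext ⟨fun e => by simp [e], fun e => by simp [e]⟩
  simp [permAct, Matrix.mul_apply, h]

/-- The Frobenius norm. -/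
noncomputable def frobNorm {n : ℕ} (M : Matrix (Fin n) (Fin n) ℝ) : ℝ :=
  Real.sqrt (∑ i, ∑ j, M i j ^ 2)

/-- The separation distance `ρ*(𝒯', 𝒮')`: the infimum of `‖Π₁ · Θ - Π₂ · Θ‖_F` over `Θ ∈ 𝒯'`
and over the pairs `Π₁, Π₂ ∈ 𝒮'` that differ by more than the reversal `τ`, that is, with
`Π₁⁻¹ Π₂ ∉ {Id, τ}` (a Toeplitz matrix satisfies `τ · Θ = Θ`). The infimum over an empty family
is `∞`. -/
noncomputable def sepDist {n : ℕ} (𝒯 : Set (Matrix (Fin n) (Fin n) ℝ))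
    (𝒮 : Set (Equiv.Perm (Fin n))) : ℝ≥0∞ :=
  ⨅ (Θ ∈ 𝒯) (p₁ ∈ 𝒮) (p₂ ∈ 𝒮) (_ : p₁⁻¹ * p₂ ≠ 1 ∧ p₁⁻¹ * p₂ ≠ Fin.revPerm),
    ENNReal.ofReal (frobNorm (permAct p₁ Θ - permAct p₂ Θ))

/-- The rate `A √n + √A n^{3/4} log^{1/4} n`. -/
noncomputable def seriationRate (n : ℕ) (A : ℝ) : ℝ :=
  A * Real.sqrt n + Real.sqrt A * (n : ℝ) ^ (3 / 4 : ℝ) * Real.log n ^ (1 / 4 : ℝ)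

/-! ## Computations with a step count

A computation returns a value together with the number of elementary steps it took, in the real
RAM model: an arithmetic operation on real numbers, a comparison, a read or write in a table, a
membership test or an update of a subset of `[n]` (stored as a bit table) counts for one step. -/

structure Timed (α : Type) where
  val : α
  steps : ℕ

namespace Timed

instance : Monad Timed where
  pure a := ⟨a, 0⟩
  bind x f := ⟨(f x.val).val, x.steps + (f x.val).steps⟩

variable {n : ℕ} {α : Type}

/-- Compute `a` by `k` elementary operations. -/
def ops (k : ℕ) (a : α) : Timed α := ⟨a, k⟩

/-- `for i in [n]`: store the result of `f i` in a table. -/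
def table (f : Fin n → Timed α) : Timed (Fin n → α) :=
  ⟨fun i => (f i).val, ∑ i, ((f i).steps + 1)⟩

/-- `for i in [n]`: add the result of `f i` to an accumulator. -/
noncomputable def sum (f : Fin n → Timed ℝ) : Timed ℝ :=
  ⟨∑ i, (f i).val, ∑ i, ((f i).steps + 1)⟩

/-- `for i in [n]`: collect the indices that pass the test `f`. -/
def select (f : Fin n → Timed Bool) : Timed (Finset (Fin n)) :=
  ⟨Finset.univ.filter fun i => (f i).val = true, ∑ i, ((f i).steps + 1)⟩

/-- `for i in [n]`: test whether all the `f i` hold. -/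
def all (f : Fin n → Timed Bool) : Timed Bool :=
  ⟨decide (∀ i, (f i).val = true), ∑ i, ((f i).steps + 1)⟩

/-- `for i in [n]`: test whether one of the `f i` holds. -/
def any (f : Fin n → Timed Bool) : Timed Bool :=
  ⟨decide (∃ i, (f i).val = true), ∑ i, ((f i).steps + 1)⟩

/-- `for i in [n]`: the largest of the values `v i`, `i ∈ s` (and `0` if `s` is empty). -/
noncomputable def max (s : Finset (Fin n)) (v : Fin n → ℝ) : Timed ℝ :=
  ⟨if h : s.Nonempty then s.sup' h v else 0, ∑ _i : Fin n, 3⟩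

end Timed

/-! ## The procedure PINES -/

namespace Pines

/-- The places where the procedure makes an arbitrary choice in a set of candidates. -/
inductive Stage
  | center
  | extremal
  | next
  | inCell

/-- A way to resolve the arbitrary choices of the procedure. In each stage, a run never meets the
same nonempty set of candidates twice, so every run is obtained for some choice functions. When the
procedure raises an error, the output is an arbitrary permutation. -/
structure Choices (n : ℕ) where
  pick : Stage → Finset (Fin n) → Fin n
  pick_mem : ∀ (s : Stage) (t : Finset (Fin n)), t.Nonempty → pick s t ∈ t
  onError : Equiv.Perm (Fin n)

variable {n : ℕ}

/-- Scan the set of candidates and take one of them, if there is one. -/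
def take (ch : Choices n) (s : Stage) (t : Finset (Fin n)) : Timed (Option (Fin n)) :=
  ⟨if t.Nonempty then some (ch.pick s t) else none, n + 1⟩

/-- The estimated distances `d̂(i,j) = √(U_i + U_j - 2⟨Y_i, Y_j⟩)`, where
`U_i = max {⟨Y_i, Y_j⟩ | j ∈ N_i}`, `N_i = {j ≠ i | |S_j - S_i| ≤ c₁ (A + √(n log n))}` and
`S_i = ∑_j Y_{i,j}`. A negative value under the root is replaced by `0`, and `d̂(i,i) = 0`. -/
noncomputable def distances (c₁ A : ℝ) (Y : Matrix (Fin n) (Fin n) ℝ) :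
    Timed (Fin n → Fin n → ℝ) := do
  let S ← Timed.table fun i => Timed.sum fun j => Timed.ops 1 (Y i j)
  let G ← Timed.table fun i => Timed.table fun j =>
    Timed.sum fun k => Timed.ops 3 (Y i k * Y j k)
  let r ← Timed.ops 5 (c₁ * (A + Real.sqrt (n * Real.log n)))
  let U ← Timed.table fun i => do
    let N ← Timed.select fun j => Timed.ops 6 (decide (j ≠ i ∧ |S j - S i| ≤ r))
    Timed.max N (G i)
  Timed.table fun i => Timed.table fun j =>
    Timed.ops 10 (if i = j then 0 else Real.sqrt (U i + U j - 2 * G i j))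

/-- Build a maximal `ρ₁`-packing and the associated partition: as long as `D ≠ [n]`, take `i ∉ D`,
add it to the packing, let its cell be `{j ∉ D | d̂(i,j) ≤ ρ₁}`, and add the cell to `D`. The
result is the packing and the map that sends the points of the packing to their cells. The first
argument bounds the number of turns; `n` turns are enough. -/
noncomputable def packing (ch : Choices n) (d : Fin n → Fin n → ℝ) (ρ₁ : ℝ) :
    ℕ → Finset (Fin n) → Timed (Finset (Fin n) × (Fin n → Finset (Fin n)))
  | 0, _ => Timed.ops n (∅, fun _ => ∅)
  | m + 1, D => do
    let R ← Timed.ops n Dᶜ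
    match ← take ch Stage.center R with
    | none => Timed.ops n (∅, fun _ => ∅)
    | some i => do
      let Q ← Timed.select fun j => Timed.ops 3 (decide (j ∉ D ∧ d i j ≤ ρ₁))
      let D' ← Timed.ops n (D ∪ Q)
      let rest ← packing ch d ρ₁ m D'
      Timed.ops (n + 1) (insert i rest.1, Function.update rest.2 i Q)

/-- Add `m` times the neighbours of `R` in the graph `G_i`: its vertices are the `v` with
`d̂(i,v) > ρ₂`, and two vertices `u`, `v` are adjacent if `d̂(u,v) ≤ ρ₃`. -/
noncomputable def explore (d : Fin n → Fin n → ℝ) (ρ₂ ρ₃ : ℝ) (i : Fin n) :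
    ℕ → Finset (Fin n) → Timed (Finset (Fin n))
  | 0, R => pure R
  | m + 1, R => do
    let R' ← Timed.select fun v => Timed.any fun u =>
      Timed.ops 8 (decide (v ∈ R ∨ (u ∈ R ∧ ρ₂ < d i u ∧ ρ₂ < d i v ∧ d u v ≤ ρ₃)))
    explore d ρ₂ ρ₃ i m R'

/-- For `i` in the packing `P` and `j ∈ P \ {i}`, the entry `(i, j)` is the class of `j` in
`P \ {i}`, two points being equivalent if they are connected in `G_i`. -/
noncomputable def classes (d : Fin n → Fin n → ℝ) (ρ₂ ρ₃ : ℝ) (P : Finset (Fin n)) :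
    Timed (Fin n → Fin n → Finset (Fin n)) :=
  Timed.table fun i => Timed.table fun j => do
    let R ← Timed.ops n {j}
    let R' ← explore d ρ₂ ρ₃ i n R
    Timed.select fun k => Timed.ops 3 (decide (k ∈ P ∧ k ≠ i ∧ k ∈ R'))

/-- The extremal points: the `i ∈ P` such that `P \ {i}` has at most one class. -/
def extremals (P : Finset (Fin n)) (cls : Fin n → Fin n → Finset (Fin n)) :
    Timed (Finset (Fin n)) :=
  Timed.select fun i => do
    let b ← Timed.all fun j => Timed.all fun k =>
      Timed.ops 5 (decide (j ∈ P ∧ j ≠ i ∧ k ∈ P ∧ k ≠ i → k ∈ cls i j))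
    Timed.ops 2 (decide (i ∈ P ∧ b = true))

/-- As long as `Q ≠ P`, find `i ∈ P \ Q` such that one of the classes of `P \ {i}` is `Q`, and
append `i` to `Q`. The result is the list of the appended points, or `none` for an error. The first
argument bounds the number of turns; `n` turns are enough. -/
def chain (ch : Choices n) (P : Finset (Fin n)) (cls : Fin n → Fin n → Finset (Fin n)) :
    ℕ → Finset (Fin n) → Timed (Option (List (Fin n)))
  | 0, _ => pure none
  | m + 1, Q => do
    let done ← Timed.all fun k => Timed.ops 2 (decide (k ∈ Q ↔ k ∈ P))
    if done = true then pure (some []) else do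
      let cand ← Timed.select fun i => Timed.any fun j => do
        let b ← Timed.all fun k => Timed.ops 2 (decide (k ∈ cls i j ↔ k ∈ Q))
        Timed.ops 5 (decide (i ∈ P ∧ i ∉ Q ∧ j ∈ P ∧ j ≠ i ∧ b = true))
      match ← take ch Stage.next cand with
      | none => pure none
      | some i => do
        let Q' ← Timed.ops 1 (insert i Q)
        let rest ← chain ch P cls m Q'
        Timed.ops 1 (rest.map fun l => i :: l)

/-- The ordering of the packing, or `none` for an error. -/
def orderPacking (ch : Choices n) (P : Finset (Fin n)) (cls : Fin n → Fin n → Finset (Fin n)) :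
    Timed (Option (List (Fin n))) := do
  let ext ← extremals P cls
  match ← take ch Stage.extremal ext with
  | none => pure none
  | some i => do
    let Q ← Timed.ops n {i}
    let rest ← chain ch P cls n Q
    Timed.ops 1 (rest.map fun l => i :: l)

/-- List the points of a cell in an arbitrary order. The first argument bounds the number of turns;
`n` turns are enough. -/
def listCell (ch : Choices n) : ℕ → Finset (Fin n) → Timed (List (Fin n))
  | 0, _ => pure []
  | m + 1, C => do
    match ← take ch Stage.inCell C with
    | none => pure []
    | some k => do
      let C' ← Timed.ops 1 (C.erase k)
      let rest ← listCell ch m C'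
      Timed.ops 1 (k :: rest)

/-- List all the points, cell after cell. -/
def listCells (ch : Choices n) (cell : Fin n → Finset (Fin n)) :
    List (Fin n) → Timed (List (Fin n))
  | [] => pure []
  | i :: l => do
    let first ← listCell ch n (cell i)
    let rest ← listCells ch cell l
    Timed.ops (first.length + 1) (first ++ rest)

/-- The permutation that sends every point to its position in the list `L`; the value `onError` is
used only if `L` is not an enumeration of `[n]`. -/
noncomputable def positions (onError : Equiv.Perm (Fin n)) (L : List (Fin n)) :
    Timed (Equiv.Perm (Fin n)) :=
  open scoped Classical in
  Timed.ops ((n + 1) * (L.length + 1))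
    (if h : ∃ p : Equiv.Perm (Fin n), ∀ k, (p k : ℕ) = L.idxOf k then h.choose else onError)

/-- PINES with the estimated distance `d` and the radii `ρ₁`, `ρ₂`, `ρ₃`. -/
noncomputable def run (ch : Choices n) (d : Fin n → Fin n → ℝ) (ρ₁ ρ₂ ρ₃ : ℝ) :
    Timed (Equiv.Perm (Fin n)) := do
  let D ← Timed.ops n (∅ : Finset (Fin n))
  let part ← packing ch d ρ₁ n D
  let cls ← classes d ρ₂ ρ₃ part.1
  match ← orderPacking ch part.1 cls with
  | none => pure ch.onError
  | some order => do
    let L ← listCells ch part.2 order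
    positions ch.onError L

/-- PINES for the Toeplitz model with entries in `[0, A]`: the distances are estimated from the
observation `Y`, and the radii are
`ρ₃ = δ + ε`, `ρ₂ = α δ + 2 (1 + α) ε`, `ρ₁ = α² δ + (2 α² + 3 α + 2) ε` with
`α = √2`, `δ = √2 A` and `ε = c₂ (A + √A (n log n)^{1/4})`. -/
noncomputable def pines (c₁ c₂ A : ℝ) (Y : Matrix (Fin n) (Fin n) ℝ) (ch : Choices n) :
    Timed (Equiv.Perm (Fin n)) := do
  let d ← distances c₁ A Y
  let α ← Timed.ops 1 (Real.sqrt 2)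
  let δ ← Timed.ops 1 (α * A)
  let ε ← Timed.ops 8 (c₂ * (A + Real.sqrt A * (n * Real.log n) ^ (1 / 4 : ℝ)))
  let ρ₃ ← Timed.ops 1 (δ + ε)
  let ρ₂ ← Timed.ops 5 (α * δ + 2 * (1 + α) * ε)
  let ρ₁ ← Timed.ops 9 (α ^ 2 * δ + (2 * α ^ 2 + 3 * α + 2) * ε)
  run ch d ρ₁ ρ₂ ρ₃

end Pines

/-! The proof separates a deterministic analysis of the ordering from a concentration bound for the
noise. Let `D` be the Euclidean distance between the rows of `X`. Along the true order, `D` is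
monotone up to the factor `α = √2` (`sum_sq_sub_le_two_mul`, by a reflection argument), and
consecutive rows are within `δ = √2 A` (a telescoping total variation bound). `IsSeriated` retains
just this.

Suppose that `d` is within `ε` of `D`. The radii form a ladder. At radius `ρ₃` consecutive points
are adjacent; outside radius `ρ₂` around `i` no such edge can jump over `i`; and if a center is
beyond `ρ₁` from `i`, then every point further out on its side stays beyond `ρ₂`. Hence the classes
of the packing without `i` are exactly its two sides (`classes_isSides`), and the packing gets
sorted up to reversal. Concatenating the cells can then misorder only pairs at distance `O(δ + ε)`
(`run_spec`). By pigeonhole each row lands at a position whose true row is `O(δ + ε)` away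
(`displacement`), and permuting rows and columns turns this into a Frobenius loss of order `√n ε`,
since `A ≤ ε`.

It remains to estimate `D`. Inner products of distinct noisy rows concentrate, but the square norm
of a noisy row is biased by the unknown noise variance. It is replaced by `U_i`, a maximum of inner
products with rows of similar sum. A neighbour in the true order is a candidate, which bounds `U_i`
below. Above, a candidate cannot have a much larger norm, because row norms of a Robinson Toeplitz
matrix vary at most `2A` times as much as row sums (`abs_sum_sq_sub_le`). This gives
`distances_accurate`. The noise bounds come from Chernoff's method with a Gaussian linearisation of
products, and fail with probability at most `6 / n`; for `n` too small compared with `δ`, the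
trivial bound `A n` on the loss suffices.

Perfect recovery follows on the same event: a loss below the separation leaves only the identity and
the reversal. -/

/-! ### Dissimilarities that follow a linear order up to a constant factor. -/

/-- A dissimilarity `D` compatible, up to the factor `α`, with the linear order given by `pos`, in
which consecutive points are `δ`-close. -/
structure IsSeriated {n : ℕ} (pos : Equiv.Perm (Fin n)) (D : Fin n → Fin n → ℝ) (α δ : ℝ) :
    Prop where
  self : ∀ i, D i i = 0
  symm : ∀ i j, D i j = D j i
  triangle : ∀ i j k, D i k ≤ D i j + D j k
  step : ∀ i j, (pos j : ℕ) = pos i + 1 → D i j ≤ δ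
  left : ∀ i j k, pos i ≤ pos j → pos j ≤ pos k → D i j ≤ α * D i k
  right : ∀ i j k, pos i ≤ pos j → pos j ≤ pos k → D j k ≤ α * D i k

namespace IsSeriated

variable {n : ℕ} {pos : Equiv.Perm (Fin n)} {D d : Fin n → Fin n → ℝ} {α δ ε : ℝ}

/-- Reversal exchanges the two monotonicity fields, so arguments on one side of a point transfer to
the other side. -/
theorem rev (h : IsSeriated pos D α δ) : IsSeriated (pos.trans Fin.revPerm) D α δ where
  self := h.self
  symm := h.symm
  triangle := h.triangle
  step i j hij := by
    rw [h.symm]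
    apply h.step
    simp only [Equiv.trans_apply, Fin.revPerm_apply, Fin.val_rev] at hij
    omega
  left i j k hij hjk := by
    simp only [Equiv.trans_apply, Fin.revPerm_apply, Fin.rev_le_rev] at hij hjk
    rw [h.symm i j, h.symm i k]
    exact h.right k j i hjk hij
  right i j k hij hjk := by
    simp only [Equiv.trans_apply, Fin.revPerm_apply, Fin.rev_le_rev] at hij hjk
    rw [h.symm j k, h.symm i k]
    exact h.left k j i hjk hij

theorem nonneg (h : IsSeriated pos D α δ) (i j : Fin n) : 0 ≤ D i j := by
  have h1 := h.triangle i i i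
  have h2 := h.triangle i j i
  rw [h.symm j i] at h2
  linarith

/-- No short edge crosses a vertex that is far from one of its ends. -/
theorem not_adj_across (h : IsSeriated pos D α δ) (hα : 1 ≤ α) (hε : 0 < ε)
    (hd : ∀ i j, |d i j - D i j| ≤ ε) {i u v : Fin n} (hu : pos u < pos i) (hv : pos i < pos v)
    (h2 : α * δ + 2 * (1 + α) * ε < d i u) (h3 : d u v ≤ δ + ε) : False := by
  have e1 := abs_le.1 (hd i u)
  have e2 := abs_le.1 (hd u v)
  have e3 := h.left u i v hu.le hv.le
  rw [h.symm] at e3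
  have : α * D u v ≤ α * (δ + 2 * ε) := by
    apply mul_le_mul_of_nonneg_left _ (by linarith)
    linarith
  nlinarith

/-- If points are misordered although they belong to cells whose centers are well ordered, then
they are close to each other. -/
theorem close_of_misordered (h : IsSeriated pos D α δ) (hα : 1 ≤ α) {κ : ℝ} {a b u v : Fin n}
    (hau : D a u ≤ κ) (hbv : D b v ≤ κ) (hab : pos a < pos b) (hvu : pos v < pos u) :
    D u v ≤ (1 + α) * κ := by
  have hα0 : 0 ≤ α := by linarith
  have hκ : 0 ≤ κ := (h.nonneg _ _).trans hau
  -- If `v` is before `a`, then `a` lies between `v` and `b`, so `D v a ≤ α κ`, and the triangle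
  -- through `a` costs one more `κ`. Otherwise `v` lies between `a` and `u`, and `α κ` alone
  -- suffices.
  rcases le_total (pos v) (pos a) with hva | hva
  · have e1 := h.left v a b hva hab.le
    rw [h.symm v b] at e1
    have e2 := mul_le_mul_of_nonneg_left hbv hα0
    have e3 := h.triangle u a v
    rw [h.symm u a, h.symm a v] at e3
    linarith
  · have e1 := h.right a v u hva hvu.le
    have e2 := mul_le_mul_of_nonneg_left hau hα0
    rw [h.symm u v]
    linarith

end IsSeriated

namespace Pines

variable {n : ℕ} {pos : Equiv.Perm (Fin n)} {D d : Fin n → Fin n → ℝ} {α δ ε : ℝ}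

theorem take_val (ch : Choices n) (s : Stage) (t : Finset (Fin n)) :
    (take ch s t).val = none ∧ t = ∅ ∨ ∃ i ∈ t, (take ch s t).val = some i := by
  by_cases ht : t.Nonempty
  · exact Or.inr ⟨ch.pick s t, ch.pick_mem s t ht, by simp [take, ht]⟩
  · exact Or.inl ⟨by simp [take, ht], Finset.not_nonempty_iff_eq_empty.1 ht⟩

/-! ### Packing -/

/-- The set `D` of points already covered is kept as a parameter so that the property passes through
the recursion; the packing of interest has `D = ∅`. -/
structure IsPacking (d : Fin n → Fin n → ℝ) (ρ : ℝ) (D P : Finset (Fin n))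
    (cell : Fin n → Finset (Fin n)) : Prop where
  subset : ∀ i ∈ P, i ∉ D
  separated : ∀ i ∈ P, ∀ j ∈ P, i ≠ j → ρ < d i j
  near : ∀ i ∈ P, ∀ j ∈ cell i, d i j ≤ ρ
  disjoint_start : ∀ i ∈ P, ∀ j ∈ cell i, j ∉ D
  disjoint : ∀ i ∈ P, ∀ j ∈ P, i ≠ j → Disjoint (cell i) (cell j)
  cover : ∀ k, k ∉ D → ∃ i ∈ P, k ∈ cell i

/-- A later center is separated from an earlier one because it escaped the earlier cell while still
uncovered. Since `d i i = 0 ≤ ρ`, a center lies in its own cell, so each turn covers a new point and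
the number of turns suffices. -/
theorem packing_isPacking (ch : Choices n) {ρ : ℝ} (hρ : 0 ≤ ρ) (hd0 : ∀ i, d i i = 0)
    (hds : ∀ i j, d i j = d j i) (m : ℕ) (D : Finset (Fin n)) (hm : Dᶜ.card ≤ m) :
    IsPacking d ρ D (packing ch d ρ m D).val.1 (packing ch d ρ m D).val.2 := by
  have empty_case : ∀ D : Finset (Fin n), Dᶜ = ∅ → IsPacking d ρ D ∅ (fun _ => ∅) := by
    intro D hD
    refine ⟨by simp, by simp, by simp, by simp, by simp, fun k hk => ?_⟩
    have : k ∈ Dᶜ := by simpa using hk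
    simp [hD] at this
  induction m generalizing D with
  | zero => exact empty_case D (Finset.card_eq_zero.1 (Nat.le_zero.1 hm))
  | succ m ih =>
    rcases take_val ch Stage.center Dᶜ with ⟨h1, h2⟩ | ⟨i, hi, h1⟩
    · have : (packing ch d ρ (m + 1) D).val = (∅, fun _ => ∅) := by
        simp only [packing, bind, Timed.ops, h1]
      rw [this]
      exact empty_case D h2
    · set Q : Finset (Fin n) := Finset.univ.filter fun j => j ∉ D ∧ d i j ≤ ρ with hQ
      have hval : (packing ch d ρ (m + 1) D).val =
          (insert i (packing ch d ρ m (D ∪ Q)).val.1,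
            Function.update (packing ch d ρ m (D ∪ Q)).val.2 i Q) := by
        simp only [packing, bind, Timed.ops, h1, Timed.select, hQ, decide_eq_true_eq]
      have hiD : i ∉ D := by simpa using hi
      have hiQ : i ∈ Q := by simp [hQ, hiD, hd0, hρ]
      have key := ih (D ∪ Q) (by
        have : (D ∪ Q)ᶜ.card < Dᶜ.card := Finset.card_lt_card (by
          refine ⟨by intro x; simp; tauto, fun hsub => ?_⟩
          have := hsub hi
          simp [hiQ] at this)
        omega)
      rw [hval]
      generalize packing ch d ρ m (D ∪ Q) = rest at key
      have hsub : ∀ j ∈ rest.val.1, j ∉ D ∧ j ∉ Q := fun j hj => by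
        simpa using key.subset j hj
      have hne : ∀ j ∈ rest.val.1, j ≠ i := fun j hj e => (hsub j hj).2 (e ▸ hiQ)
      have hfar : ∀ j ∈ rest.val.1, ρ < d i j := fun j hj => by
        have := hsub j hj
        simp only [hQ, Finset.mem_filter, Finset.mem_univ, true_and, not_and, not_le] at this
        exact this.2 this.1
      have hst : ∀ j ∈ rest.val.1, ∀ k ∈ rest.val.2 j, k ∉ D ∧ k ∉ Q := fun j hj k hk => by
        simpa using key.disjoint_start j hj k hk
      refine ⟨?_, ?_, ?_, ?_, ?_, ?_⟩
      · intro j hj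
        rcases Finset.mem_insert.1 hj with rfl | hj
        · exact hiD
        · exact (hsub j hj).1
      · intro j hj k hk hjk
        rcases Finset.mem_insert.1 hj with hji | hj' <;>
          rcases Finset.mem_insert.1 hk with hki | hk'
        · exact absurd (hji.trans hki.symm) hjk
        · exact hji ▸ hfar k hk'
        · rw [hds]; exact hki ▸ hfar j hj'
        · exact key.separated j hj' k hk' hjk
      · intro j hj k hk
        rcases Finset.mem_insert.1 hj with rfl | hj
        · simp only [Function.update_self, hQ, Finset.mem_filter] at hk
          exact hk.2.2
        · simp only [Function.update_of_ne (hne j hj)] at hk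
          exact key.near j hj k hk
      · intro j hj k hk
        rcases Finset.mem_insert.1 hj with rfl | hj
        · simp only [Function.update_self, hQ, Finset.mem_filter] at hk
          exact hk.2.1
        · simp only [Function.update_of_ne (hne j hj)] at hk
          exact (hst j hj k hk).1
      · intro j hj k hk hjk
        rcases Finset.mem_insert.1 hj with hji | hj' <;>
          rcases Finset.mem_insert.1 hk with hki | hk'
        · exact absurd (hji.trans hki.symm) hjk
        · simp only [hji, Function.update_self, Function.update_of_ne (hne k hk')]
          exact Finset.disjoint_right.2 fun x hx => (hst k hk' x hx).2
        · simp only [hki, Function.update_self, Function.update_of_ne (hne j hj')]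
          exact Finset.disjoint_left.2 fun x hx => (hst j hj' x hx).2
        · simp only [Function.update_of_ne (hne j hj'), Function.update_of_ne (hne k hk')]
          exact key.disjoint j hj' k hk' hjk
      · intro k hk
        by_cases hkQ : k ∈ Q
        · exact ⟨i, Finset.mem_insert_self _ _, by simpa using hkQ⟩
        · obtain ⟨j, hj, hkj⟩ := key.cover k (by simp [hk, hkQ])
          refine ⟨j, Finset.mem_insert_of_mem hj, ?_⟩
          simpa only [Function.update_of_ne (hne j hj)] using hkj

/-! ### Classes -/

/-- One turn of `explore`. -/
noncomputable def expand (d : Fin n → Fin n → ℝ) (ρ₂ ρ₃ : ℝ) (i : Fin n) (R : Finset (Fin n)) :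
    Finset (Fin n) :=
  open scoped Classical in
  Finset.univ.filter fun v => ∃ u, v ∈ R ∨ (u ∈ R ∧ ρ₂ < d i u ∧ ρ₂ < d i v ∧ d u v ≤ ρ₃)

theorem explore_succ_val (ρ₂ ρ₃ : ℝ) (i : Fin n) (m : ℕ) (R : Finset (Fin n)) :
    (explore d ρ₂ ρ₃ i (m + 1) R).val = (explore d ρ₂ ρ₃ i m (expand d ρ₂ ρ₃ i R)).val := by
  have : (Timed.select fun v => Timed.any fun u => Timed.ops 8 (decide (v ∈ R ∨
      (u ∈ R ∧ ρ₂ < d i u ∧ ρ₂ < d i v ∧ d u v ≤ ρ₃)))).val = expand d ρ₂ ρ₃ i R := by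
    ext v
    simp [Timed.select, Timed.any, Timed.ops, expand]
  rw [← this]
  rfl

/-- An exploration that starts before `i` cannot land on `i`, which is no vertex of its own graph as
`d i i = 0`, nor jump over it, by `not_adj_across`. -/
theorem explore_side (h : IsSeriated pos D α δ) (hα : 1 ≤ α) (hδ : 0 ≤ δ) (hε : 0 < ε)
    (hd : ∀ i j, |d i j - D i j| ≤ ε) (hd0 : ∀ i, d i i = 0) (i : Fin n) (m : ℕ)
    (R : Finset (Fin n)) (hR : ∀ v ∈ R, pos v < pos i) :
    ∀ v ∈ (explore d (α * δ + 2 * (1 + α) * ε) (δ + ε) i m R).val, pos v < pos i := by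
  induction m generalizing R with
  | zero => exact hR
  | succ m ih =>
    rw [explore_succ_val]
    refine ih _ fun v hv => ?_
    simp only [expand, Finset.mem_filter, Finset.mem_univ, true_and] at hv
    obtain ⟨u, hv | ⟨hu, h2, h2', h3⟩⟩ := hv
    · exact hR v hv
    · rcases lt_trichotomy (pos v) (pos i) with hvi | hvi | hvi
      · exact hvi
      · rw [pos.injective hvi, hd0] at h2'
        have : 0 ≤ α * δ + 2 * (1 + α) * ε := by positivity
        linarith
      · exact (h.not_adj_across hα hε hd (hR u hu) hvi h2 h3).elim

theorem subset_explore (ρ₂ ρ₃ : ℝ) (i : Fin n) (m : ℕ) (R : Finset (Fin n)) :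
    R ⊆ (explore d ρ₂ ρ₃ i m R).val := by
  induction m generalizing R with
  | zero => exact subset_rfl
  | succ m ih =>
    rw [explore_succ_val]
    refine subset_trans (fun v hv => ?_) (ih _)
    simp only [expand, Finset.mem_filter, Finset.mem_univ, true_and]
    exact ⟨v, Or.inl hv⟩

/-- Walk from `j` down to `k` through consecutive positions: each point met is a vertex by `hfar`,
and each step is an edge because `D ≤ δ` there and `d` errs by at most `ε`. -/
theorem explore_reach (h : IsSeriated pos D α δ) {ρ₂ : ℝ} (hd : ∀ i j, |d i j - D i j| ≤ ε)
    (i k : Fin n) (m : ℕ) (j : Fin n) (R : Finset (Fin n)) (hj : j ∈ R) (hkj : pos k ≤ pos j)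
    (hm : (pos j : ℕ) ≤ pos k + m) (hfar : ∀ v, pos k ≤ pos v → pos v ≤ pos j → ρ₂ < d i v) :
    k ∈ (explore d ρ₂ (δ + ε) i m R).val := by
  induction m generalizing j R with
  | zero =>
    have : k = j := pos.injective (le_antisymm hkj (by rw [Fin.le_def]; omega))
    exact this ▸ hj
  | succ m ih =>
    rcases hkj.eq_or_lt with e | hlt
    · exact subset_explore _ _ _ _ _ (pos.injective e ▸ hj)
    · rw [explore_succ_val]
      rw [Fin.lt_def] at hlt
      obtain ⟨v, hv⟩ := pos.surjective ⟨(pos j : ℕ) - 1, by omega⟩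
      have hv' : (pos v : ℕ) = pos j - 1 := by rw [hv]
      have hkv : pos k ≤ pos v := by rw [Fin.le_def]; omega
      have hvj : pos v ≤ pos j := by rw [Fin.le_def]; omega
      refine ih v _ ?_ hkv (by omega) fun w hw hw' => hfar w hw (hw'.trans hvj)
      simp only [expand, Finset.mem_filter, Finset.mem_univ, true_and]
      refine ⟨j, Or.inr ⟨hj, hfar j hkj le_rfl, hfar v hkv hvj, ?_⟩⟩
      have e1 := h.step v j (by omega)
      rw [h.symm] at e1
      have := abs_le.1 (hd j v)
      linarith

/-- `cls` cuts `P` into the points before and the points after `i`. -/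
def IsSides (pos : Equiv.Perm (Fin n)) (P : Finset (Fin n))
    (cls : Fin n → Fin n → Finset (Fin n)) : Prop :=
  ∀ i ∈ P, ∀ j ∈ P, j ≠ i → ∀ k, k ∈ cls i j ↔ k ∈ P ∧ k ≠ i ∧ (pos k < pos i ↔ pos j < pos i)

theorem IsSides.rev {P : Finset (Fin n)} {cls : Fin n → Fin n → Finset (Fin n)}
    (h : IsSides pos P cls) : IsSides (pos.trans Fin.revPerm) P cls := by
  intro i hi j hj hji k
  rw [h i hi j hj hji k]
  simp only [Equiv.trans_apply, Fin.revPerm_apply, Fin.rev_lt_rev]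
  refine and_congr_right fun _ => and_congr_right fun hki => ?_
  have h1 : pos k ≠ pos i := fun e => hki (pos.injective e)
  have h2 : pos j ≠ pos i := fun e => hji (pos.injective e)
  rw [← not_le (a := pos i), ← not_le (a := pos i), h1.symm.le_iff_lt, h2.symm.le_iff_lt,
    not_iff_not]

theorem mem_explore_of_lt (h : IsSeriated pos D α δ) (hα : 1 ≤ α) (hε : 0 < ε)
    (hd : ∀ i j, |d i j - D i j| ≤ ε) {P : Finset (Fin n)}
    (hP : ∀ i ∈ P, ∀ j ∈ P, i ≠ j → α ^ 2 * δ + (2 * α ^ 2 + 3 * α + 2) * ε < d i j)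
    {i j k : Fin n} (hi : i ∈ P) (hj : j ∈ P) (hk : k ∈ P) (hji : pos j < pos i)
    (hki : pos k < pos i) :
    k ∈ (explore d (α * δ + 2 * (1 + α) * ε) (δ + ε) i n {j}).val := by
  -- This fixes `ρ₁`. If `d i v ≤ ρ₂` for some `v` beyond `w`, then `D i w ≤ α D i v ≤ α (ρ₂ + ε) =
  -- α² δ + (2α² + 3α) ε`, whereas separation gives `D i w > ρ₁ - ε`, which is larger by `ε`.
  have far : ∀ w ∈ P, pos w < pos i → ∀ v, pos v ≤ pos w → α * δ + 2 * (1 + α) * ε < d i v := by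
    intro w hw hwi v hvw
    have e1 := hP i hi w hw (fun e => by simp [e] at hwi)
    have e2 := abs_le.1 (hd i w)
    have e3 := abs_le.1 (hd i v)
    have e4 := h.right v w i hvw hwi.le
    rw [h.symm w i, h.symm v i] at e4
    by_contra hcon
    have e5 : α * D i v ≤ α * (α * δ + 2 * (1 + α) * ε + ε) :=
      mul_le_mul_of_nonneg_left (by linarith) (by linarith)
    nlinarith
  rcases le_total (pos k) (pos j) with hkj | hkj
  -- All points on the path are at least as far out as whichever of `j`, `k` is nearer to `i`, so
  -- `far` applies to that one. The outward walk uses the order itself, the inward walk the reversed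
  -- order.
  · exact explore_reach h hd i k n j _ (by simp) hkj (by omega) fun v _ hv => far j hj hji v hv
  · refine explore_reach h.rev hd i k n j _ (by simp) ?_ ?_ fun v hv _ => far k hk hki v ?_
    · simpa using hkj
    · have := ((pos.trans Fin.revPerm) j).isLt
      omega
    · simpa using hv

theorem classes_isSides (h : IsSeriated pos D α δ) (hα : 1 ≤ α) (hδ : 0 ≤ δ) (hε : 0 < ε)
    (hd : ∀ i j, |d i j - D i j| ≤ ε) (hd0 : ∀ i, d i i = 0) {P : Finset (Fin n)}
    (hP : ∀ i ∈ P, ∀ j ∈ P, i ≠ j → α ^ 2 * δ + (2 * α ^ 2 + 3 * α + 2) * ε < d i j) :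
    IsSides pos P (classes d (α * δ + 2 * (1 + α) * ε) (δ + ε) P).val := by
  have key : ∀ pos' : Equiv.Perm (Fin n), IsSeriated pos' D α δ → ∀ i ∈ P, ∀ j ∈ P, ∀ k ∈ P,
      pos' j < pos' i →
      (k ∈ (explore d (α * δ + 2 * (1 + α) * ε) (δ + ε) i n {j}).val ↔ pos' k < pos' i) :=
    fun pos' h' i hi j hj k hk hji =>
      ⟨fun hm => explore_side h' hα hδ hε hd hd0 i n {j} (by simpa using hji) k hm,
        fun hki => mem_explore_of_lt h' hα hε hd hP hi hj hk hji hki⟩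
  intro i hi j hj hji k
  have hval : (classes d (α * δ + 2 * (1 + α) * ε) (δ + ε) P).val i j =
      Finset.univ.filter fun k => k ∈ P ∧ k ≠ i ∧
        k ∈ (explore d (α * δ + 2 * (1 + α) * ε) (δ + ε) i n {j}).val := by
    refine Eq.trans (b := Finset.univ.filter fun k => decide (k ∈ P ∧ k ≠ i ∧
      k ∈ (explore d (α * δ + 2 * (1 + α) * ε) (δ + ε) i n {j}).val) = true) rfl ?_
    simp only [decide_eq_true_eq]
  rw [hval]
  simp only [Finset.mem_filter, Finset.mem_univ, true_and]
  refine and_congr_right fun hk => and_congr_right fun hki => ?_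
  have h1 : pos k ≠ pos i := fun e => hki (pos.injective e)
  have h2 : pos j ≠ pos i := fun e => hji (pos.injective e)
  rcases lt_or_gt_of_ne h2 with h2 | h2
  · rw [key pos h i hi j hj k hk h2]
    simp [h2]
  · rw [key _ h.rev i hi j hj k hk (by simpa using h2)]
    simp only [Equiv.trans_apply, Fin.revPerm_apply, Fin.rev_lt_rev]
    rw [← not_le, h1.le_iff_lt, iff_false_right h2.not_gt]

/-! ### Ordering -/

/-- The invariant is that `Q` is a nonempty initial segment of `P`. A point has `Q` as one of its
sides exactly when it is the first point of `P` outside `Q`, so the choice is forced. The strict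
bound on the turns leaves one for noticing that `Q = P`. -/
theorem chain_spec (ch : Choices n) {P : Finset (Fin n)} {cls : Fin n → Fin n → Finset (Fin n)}
    (h : IsSides pos P cls) (m : ℕ) (Q : Finset (Fin n)) (hQ : Q.Nonempty) (hQP : Q ⊆ P)
    (hlt : ∀ q ∈ Q, ∀ i ∈ P, i ∉ Q → pos q < pos i) (hm : (P \ Q).card < m) :
    ∃ l, (chain ch P cls m Q).val = some l ∧ l.Pairwise (fun i j => pos i < pos j) ∧
      ∀ k, k ∈ l ↔ k ∈ P ∧ k ∉ Q := by
  induction m generalizing Q with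
  | zero => omega
  | succ m ih =>
    by_cases hdone : Q = P
    · refine ⟨[], ?_, by simp, by simp [hdone]⟩
      subst hdone
      simp [chain, bind, Timed.all, Timed.ops, pure]
    · have hdone' : ¬ ∀ k, k ∈ Q ↔ k ∈ P := fun e => hdone (Finset.ext e)
      set cand : Finset (Fin n) := Finset.univ.filter fun i =>
        ∃ j, i ∈ P ∧ i ∉ Q ∧ j ∈ P ∧ j ≠ i ∧ ∀ k, k ∈ cls i j ↔ k ∈ Q with hcand
      obtain ⟨q, hq⟩ := hQ
      have hrest : (P \ Q).Nonempty := by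
        rw [Finset.sdiff_nonempty]
        exact fun hPQ => hdone (hQP.antisymm hPQ)
      have hmem : ∀ i, i ∈ cand ↔ i ∈ P ∧ i ∉ Q ∧ ∀ k ∈ P, k ∉ Q → pos i ≤ pos k := by
        intro i
        simp only [hcand, Finset.mem_filter, Finset.mem_univ, true_and]
        constructor
        · rintro ⟨j, hi, hiQ, hj, hji, hk⟩
          refine ⟨hi, hiQ, fun k hkP hkQ => ?_⟩
          by_contra hcon
          rw [not_le] at hcon
          have h1 := (h i hi j hj hji q).1 ((hk q).2 hq)
          have h2 := hlt q hq i hi hiQ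
          exact hkQ ((hk k).1 ((h i hi j hj hji k).2 ⟨hkP, fun e => by simp [e] at hcon,
            iff_of_true hcon (h1.2.2.1 h2)⟩))
        · rintro ⟨hi, hiQ, hmin⟩
          refine ⟨q, hi, hiQ, hQP hq, fun e => hiQ (e ▸ hq), fun k => ?_⟩
          rw [h i hi q (hQP hq) (fun e => hiQ (e ▸ hq))]
          simp only [hlt q hq i hi hiQ, iff_true]
          constructor
          · rintro ⟨hk, _, hki⟩
            by_contra hkQ
            exact absurd (hmin k hk hkQ) (not_le.2 hki)
          · exact fun hk => ⟨hQP hk, fun e => hiQ (e ▸ hk), hlt k hk i hi hiQ⟩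
      rcases take_val ch Stage.next cand with ⟨_, h2⟩ | ⟨i, hi, h1⟩
      · obtain ⟨i, hi, hmin⟩ := Finset.exists_min_image (P \ Q) pos hrest
        rw [Finset.mem_sdiff] at hi
        have : i ∈ cand := (hmem i).2 ⟨hi.1, hi.2, fun k hk hkQ =>
          hmin k (Finset.mem_sdiff.2 ⟨hk, hkQ⟩)⟩
        simp [h2] at this
      · obtain ⟨hiP, hiQ, hmin⟩ := (hmem i).1 hi
        obtain ⟨l, hl, hpair, hml⟩ := ih (insert i Q) (Finset.insert_nonempty _ _)
          (Finset.insert_subset hiP hQP) (by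
            intro a ha b hb hbQ
            rw [Finset.mem_insert, not_or] at hbQ
            rcases Finset.mem_insert.1 ha with rfl | ha
            · exact lt_of_le_of_ne (hmin b hb hbQ.2) fun e => hbQ.1 (pos.injective e).symm
            · exact hlt a ha b hb hbQ.2) (by
            have : (P \ insert i Q).card < (P \ Q).card := Finset.card_lt_card (by
              refine ⟨fun x => by simp; tauto, fun hs => ?_⟩
              have := hs (Finset.mem_sdiff.2 ⟨hiP, hiQ⟩)
              simp at this)
            omega)
        refine ⟨i :: l, ?_, ?_, ?_⟩
        · have hc : (Timed.select fun i => Timed.any fun j => do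
              let b ← Timed.all fun k => Timed.ops 2 (decide (k ∈ cls i j ↔ k ∈ Q))
              Timed.ops 5 (decide (i ∈ P ∧ i ∉ Q ∧ j ∈ P ∧ j ≠ i ∧ b = true))).val = cand := by
            simp only [Timed.select, Timed.any, Timed.all, Timed.ops, bind, decide_eq_true_eq,
              hcand]
          have hdn : (Timed.all fun k => Timed.ops 2 (decide (k ∈ Q ↔ k ∈ P))).val = false := by
            simpa [Timed.all, Timed.ops] using hdone'
          simp only [bind] at hc
          simp only [chain, bind, hdn, hc, h1, Bool.false_eq_true, if_false]
          simp [hl, Timed.ops]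
        · refine List.pairwise_cons.2 ⟨fun a ha => ?_, hpair⟩
          have := (hml a).1 ha
          rw [Finset.mem_insert, not_or] at this
          exact lt_of_le_of_ne (hmin a this.1 this.2.2) fun e => this.2.1 (pos.injective e).symm
        · intro k
          rw [List.mem_cons, hml, Finset.mem_insert]
          by_cases hk : k = i
          · simp [hk, hiP, hiQ]
          · simp [hk]

/-- A point with at most one class has an empty side, so it is first in the order or in its
reversal; this is the only source of the reversal ambiguity. The first point of `P` shows that a
candidate exists. -/
theorem orderPacking_spec (ch : Choices n) {P : Finset (Fin n)}
    {cls : Fin n → Fin n → Finset (Fin n)} (h : IsSides pos P cls) (hP : P.Nonempty) :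
    ∃ pos' : Equiv.Perm (Fin n), (pos' = pos ∨ pos' = pos.trans Fin.revPerm) ∧
      ∃ l, (orderPacking ch P cls).val = some l ∧ l.Pairwise (fun i j => pos' i < pos' j) ∧
        ∀ k, k ∈ l ↔ k ∈ P := by
  set ext : Finset (Fin n) := Finset.univ.filter fun i => i ∈ P ∧
    ∀ j k, j ∈ P ∧ j ≠ i ∧ k ∈ P ∧ k ≠ i → k ∈ cls i j with hext
  have hev : (extremals P cls).val = ext := by
    simp only [extremals, Timed.select, Timed.all, Timed.ops, bind, decide_eq_true_eq, hext]
  rcases take_val ch Stage.extremal ext with ⟨_, h2⟩ | ⟨i, hi, h1⟩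
  · obtain ⟨i, hi, hmin⟩ := Finset.exists_min_image P pos hP
    have hle : ∀ j ∈ P, ¬ pos j < pos i := fun j hj => not_lt.2 (hmin j hj)
    have : i ∈ ext := by
      simp only [hext, Finset.mem_filter, Finset.mem_univ, true_and]
      refine ⟨hi, fun j k ⟨hj, hji, hk, hki⟩ => (h i hi j hj hji k).2 ⟨hk, hki, ?_⟩⟩
      exact iff_of_false (hle k hk) (hle j hj)
    simp [h2] at this
  · simp only [hext, Finset.mem_filter, Finset.mem_univ, true_and] at hi
    obtain ⟨hiP, hall⟩ := hi
    have hfirst : ∃ pos' : Equiv.Perm (Fin n), (pos' = pos ∨ pos' = pos.trans Fin.revPerm) ∧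
        IsSides pos' P cls ∧ ∀ j ∈ P, j ≠ i → pos' i < pos' j := by
      by_cases hex : ∃ j ∈ P, pos j < pos i
      · obtain ⟨j, hj, hji⟩ := hex
        refine ⟨_, Or.inr rfl, h.rev, fun k hk hki => ?_⟩
        have hne : j ≠ i := fun e => by simp [e] at hji
        have := ((h i hiP j hj hne k).1 (hall j k ⟨hj, hne, hk, hki⟩)).2.2.2 hji
        simpa using this
      · push Not at hex
        exact ⟨pos, Or.inl rfl, h, fun j hj hji =>
          lt_of_le_of_ne (hex j hj) fun e => hji (pos.injective e).symm⟩
    obtain ⟨pos', hpos', hs, hmin⟩ := hfirst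
    obtain ⟨l, hl, hpair, hml⟩ := chain_spec ch hs n {i} (by simp) (by simpa using hiP)
      (by
        intro q hq j hj hjq
        rw [Finset.mem_singleton] at hq hjq
        exact hq ▸ hmin j hj hjq) (by
        have h1 : (P \ {i}).card < P.card := Finset.card_lt_card (by
          refine ⟨Finset.sdiff_subset, fun hs => ?_⟩
          have := hs hiP
          simp at this)
        have h2 := Finset.card_le_univ P
        rw [Fintype.card_fin] at h2
        omega)
    refine ⟨pos', hpos', i :: l, ?_, ?_, ?_⟩
    · simp only [orderPacking, bind, hev, h1]
      simp [Timed.ops, hl]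
    · refine List.pairwise_cons.2 ⟨fun a ha => ?_, hpair⟩
      have := (hml a).1 ha
      exact hmin a this.1 (by simpa using this.2)
    · intro k
      rw [List.mem_cons, hml, Finset.mem_singleton]
      by_cases hk : k = i
      · simp [hk, hiP]
      · simp [hk]

/-! ### Listing the cells -/

theorem listCell_spec (ch : Choices n) (m : ℕ) (C : Finset (Fin n)) (hm : C.card ≤ m) :
    (listCell ch m C).val.Nodup ∧ ∀ k, k ∈ (listCell ch m C).val ↔ k ∈ C := by
  induction m generalizing C with
  | zero =>
    rw [Finset.card_eq_zero.1 (Nat.le_zero.1 hm)]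
    simp [listCell, pure]
  | succ m ih =>
    rcases take_val ch Stage.inCell C with ⟨h1, h2⟩ | ⟨i, hi, h1⟩
    · have : (listCell ch (m + 1) C).val = [] := by
        simp only [listCell, bind, h1]
        rfl
      rw [this, h2]
      simp
    · have hval : (listCell ch (m + 1) C).val = i :: (listCell ch m (C.erase i)).val := by
        simp only [listCell, bind, h1, Timed.ops]
      obtain ⟨hn, hmem⟩ := ih (C.erase i) (by
        have := Finset.card_erase_lt_of_mem hi
        omega)
      rw [hval]
      refine ⟨List.nodup_cons.2 ⟨by simp [hmem], hn⟩, fun k => ?_⟩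
      rw [List.mem_cons, hmem, Finset.mem_erase]
      by_cases hk : k = i
      · simp [hk, hi]
      · simp [hk]

theorem listCells_cons_val (ch : Choices n) (cell : Fin n → Finset (Fin n)) (i : Fin n)
    (l : List (Fin n)) :
    (listCells ch cell (i :: l)).val =
      (listCell ch n (cell i)).val ++ (listCells ch cell l).val := rfl

theorem mem_listCells (ch : Choices n) (cell : Fin n → Finset (Fin n)) (l : List (Fin n))
    (k : Fin n) : k ∈ (listCells ch cell l).val ↔ ∃ i ∈ l, k ∈ cell i := by
  have hc : ∀ i, (cell i).card ≤ n := fun i => by simpa using Finset.card_le_univ (cell i)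
  induction l with
  | nil => simp [listCells, pure]
  | cons i l ih =>
    rw [listCells_cons_val, List.mem_append, (listCell_spec ch n _ (hc i)).2 k]
    simp [ih]

theorem listCells_pairwise (ch : Choices n) (cell : Fin n → Finset (Fin n)) (l : List (Fin n))
    (r : Fin n → Fin n → Prop) (hin : ∀ i ∈ l, ∀ a ∈ cell i, ∀ b ∈ cell i, a ≠ b → r a b)
    (hout : l.Pairwise fun i j => ∀ a ∈ cell i, ∀ b ∈ cell j, r a b) :
    (listCells ch cell l).val.Pairwise r := by
  have hc : ∀ i, (cell i).card ≤ n := fun i => by simpa using Finset.card_le_univ (cell i)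
  induction l with
  | nil => simp [listCells, pure]
  | cons i l ih =>
    obtain ⟨h1, h2⟩ := List.pairwise_cons.1 hout
    obtain ⟨hn, hm⟩ := listCell_spec ch n _ (hc i)
    rw [listCells_cons_val, List.pairwise_append]
    refine ⟨?_, ih (fun j hj => hin j (List.mem_cons_of_mem _ hj)) h2, fun a ha b hb => ?_⟩
    · refine List.Pairwise.imp_of_mem (fun ha hb hab => ?_) hn
      exact hin i (List.mem_cons_self) _ ((hm _).1 ha) _ ((hm _).1 hb) hab
    · obtain ⟨j, hj, hb⟩ := (mem_listCells ch cell l b).1 hb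
      exact h1 j hj a ((hm a).1 ha) b hb

/-- A duplicate-free enumeration of all points has length `n`, so the index map is a bijection and
the fallback value is not used. -/
theorem positions_val (e : Equiv.Perm (Fin n)) (L : List (Fin n)) (hn : L.Nodup)
    (hL : ∀ k, k ∈ L) (k : Fin n) : ((positions e L).val k : ℕ) = L.idxOf k := by
  classical
  have hlen : L.length = n := by
    have : L.toFinset = Finset.univ := by ext; simp [hL]
    rw [← List.toFinset_card_of_nodup hn, this, Finset.card_fin]
  have hex : ∃ p : Equiv.Perm (Fin n), ∀ k, (p k : ℕ) = L.idxOf k := by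
    let f : Fin n → Fin n := fun k =>
      ⟨L.idxOf k, (List.idxOf_lt_length_iff.2 (hL k)).trans_eq hlen⟩
    have hf : Function.Injective f := fun a b hab => by
      simp only [f, Fin.mk.injEq] at hab
      exact (List.idxOf_inj (hL a)).1 hab
    exact ⟨Equiv.ofBijective f (Finite.injective_iff_bijective.1 hf), fun k => rfl⟩
  have hval : (positions e L).val = hex.choose := by
    simp only [positions, Timed.ops]
    exact dif_pos hex
  rw [hval]
  exact hex.choose_spec k

/-! ### Correctness of the order up to close pairs. -/

/-- The order found by PINES can differ from the true one only for pairs of close points. -/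
theorem run_spec (ch : Choices n) (hn : 0 < n) (h : IsSeriated pos D α δ) (hα : 1 ≤ α)
    (hδ : 0 ≤ δ) (hε : 0 < ε) (hd : ∀ i j, |d i j - D i j| ≤ ε) (hd0 : ∀ i, d i i = 0)
    (hds : ∀ i j, d i j = d j i) {ρ₁ : ℝ}
    (hρ : ρ₁ = α ^ 2 * δ + (2 * α ^ 2 + 3 * α + 2) * ε) :
    ∃ pos' : Equiv.Perm (Fin n), (pos' = pos ∨ pos' = pos.trans Fin.revPerm) ∧
      ∀ k l, (run ch d ρ₁ (α * δ + 2 * (1 + α) * ε) (δ + ε)).val k <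
          (run ch d ρ₁ (α * δ + 2 * (1 + α) * ε) (δ + ε)).val l → pos' l < pos' k →
        D k l ≤ (1 + α) * (ρ₁ + ε) := by
  have hρ0 : 0 ≤ ρ₁ := by rw [hρ]; positivity
  have hpack := packing_isPacking ch hρ0 hd0 hds n ∅ (by simp)
  set part := packing ch d ρ₁ n ∅ with hpart
  have hPne : part.val.1.Nonempty := by
    obtain ⟨i, hi, _⟩ := hpack.cover ⟨0, hn⟩ (by simp)
    exact ⟨i, hi⟩
  have hsides := classes_isSides h hα hδ hε hd hd0 (hρ ▸ hpack.separated)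
  obtain ⟨pos', hpos', l, hl, hpair, hml⟩ := orderPacking_spec ch hsides hPne
  have h' : IsSeriated pos' D α δ := by
    rcases hpos' with rfl | rfl
    exacts [h, h.rev]
  set L := (listCells ch part.val.2 l).val with hL
  have hval : (run ch d ρ₁ (α * δ + 2 * (1 + α) * ε) (δ + ε)).val =
      (positions ch.onError L).val := by
    simp only [run, bind, Timed.ops, ← hpart, hl, hL]
  have hmem : ∀ k, k ∈ L := fun k => by
    obtain ⟨i, hi, hk⟩ := hpack.cover k (by simp)
    exact (mem_listCells ch _ l k).2 ⟨i, (hml i).2 hi, hk⟩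
  have hnear : ∀ i ∈ part.val.1, ∀ a ∈ part.val.2 i, D i a ≤ ρ₁ + ε := fun i hi a ha => by
    have e1 := hpack.near i hi a ha
    have e2 := abs_le.1 (hd i a)
    linarith
  -- The relation carries `a ≠ b` so that absence of duplicates in `L` comes along. Within a cell
  -- the bound is `2 (ρ₁ + ε)`, and `2 ≤ 1 + α`.
  have hprel := listCells_pairwise ch part.val.2 l
    (fun a b => a ≠ b ∧ (pos' b < pos' a → D a b ≤ (1 + α) * (ρ₁ + ε))) (by
      intro i hi a ha b hb hab
      refine ⟨hab, fun _ => ?_⟩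
      have e1 := hnear i ((hml i).1 hi) a ha
      have e2 := hnear i ((hml i).1 hi) b hb
      have e3 := h.triangle a i b
      rw [h.symm a i] at e3
      nlinarith) (by
      refine List.Pairwise.imp_of_mem (fun {i j} hi hj hij a ha b hb => ⟨?_, fun hba => ?_⟩) hpair
      · rintro rfl
        have := hpack.disjoint i ((hml i).1 hi) j ((hml j).1 hj) (fun e => by simp [e] at hij)
        exact Finset.disjoint_left.1 this ha hb
      · exact h'.close_of_misordered hα (hnear i ((hml i).1 hi) a ha)
          (hnear j ((hml j).1 hj) b hb) hij hba)
  rw [← hL] at hprel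
  have hnodup : L.Nodup := hprel.imp fun hab => hab.1
  refine ⟨pos', hpos', fun k m hkm hmk => ?_⟩
  rw [hval, Fin.lt_def, positions_val _ _ hnodup hmem, positions_val _ _ hnodup hmem] at hkm
  have := List.pairwise_iff_getElem.1 hprel _ _ (List.idxOf_lt_length_iff.2 (hmem k))
    (List.idxOf_lt_length_iff.2 (hmem m)) hkm
  simp only [List.getElem_idxOf] at this
  exact this.2 hmk

end Pines

/-! ### From misordered pairs to displacements. -/

/-- A permutation that respects the order of far points moves each point by a small distance. -/
theorem IsSeriated.displacement {n : ℕ} {pos p : Equiv.Perm (Fin n)} {D : Fin n → Fin n → ℝ}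
    {α δ κ : ℝ} (h : IsSeriated pos D α δ) (hα : 0 ≤ α) (hκ : 0 ≤ κ)
    (hp : ∀ k l, p k < p l → pos l < pos k → D k l ≤ κ) (k : Fin n) :
    D k (pos.symm (p k)) ≤ α * κ := by
  have key : ∀ pos p : Equiv.Perm (Fin n), IsSeriated pos D α δ →
      (∀ k l, p k < p l → pos l < pos k → D k l ≤ κ) → pos k < p k →
      D k (pos.symm (p k)) ≤ α * κ := by
    intro pos p h hp hlt
    -- Pigeonhole: otherwise the points that `p` places before `p k` all have true position before
    -- `p k`, and so does `k`, which is one point too many. The pair `k`, `q` is then misordered,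
    -- and the true position `p k` lies between them.
    obtain ⟨q, hq1, hq2⟩ : ∃ q, p q < p k ∧ p k ≤ pos q := by
      by_contra hcon
      push Not at hcon
      have hsub : (Finset.univ.filter fun q => p q < p k) ⊂
          Finset.univ.filter fun q => pos q < p k := by
        refine ⟨fun q hq => ?_, fun hs => ?_⟩
        · simp only [Finset.mem_filter, Finset.mem_univ, true_and] at hq ⊢
          exact hcon q hq
        · have := hs (show k ∈ _ by simpa using hlt)
          simp at this
      have hcard : ∀ s : Equiv.Perm (Fin n), (Finset.univ.filter fun q => s q < p k).card =
          (Finset.univ.filter fun q => q < p k).card := fun s => by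
        rw [← Finset.card_map s.toEmbedding]
        congr 1
        ext q
        simp only [Finset.mem_map_equiv, Finset.mem_filter, Finset.mem_univ, true_and,
          Equiv.apply_symm_apply]
      have := Finset.card_lt_card hsub
      rw [hcard, hcard] at this
      exact lt_irrefl _ this
    have e1 := hp q k hq1 (hlt.trans_le hq2)
    have e2 := h.left k (pos.symm (p k)) q (by simpa using hlt.le) (by simpa using hq2)
    rw [h.symm k q] at e2
    exact e2.trans (mul_le_mul_of_nonneg_left e1 hα)
  rcases lt_trichotomy (pos k) (p k) with hlt | heq | hgt
  · exact key pos p h hp hlt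
  · rw [← heq, Equiv.symm_apply_apply]
    rw [h.self]
    positivity
  · have := key (pos.trans Fin.revPerm) (p.trans Fin.revPerm) h.rev
      (fun a b hab hba => by
        simp only [Equiv.trans_apply, Fin.revPerm_apply, Fin.rev_lt_rev] at hab hba
        rw [h.symm]
        exact hp b a hab hba) (by simpa using hgt)
    simpa using this

/-! ## Rows of a Robinson Toeplitz matrix -/

section Profile

variable {g : ℕ → ℝ} {A : ℝ}

/-- The absolute differences telescope: `H` is the row with its peak at `p + 1`, continued past the
peak by its mirror image at height `g 0`, hence increasing from a value `≥ 0` to at most `2 * g 0`.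
-/
theorem sum_abs_sub_shift_le (hg : Antitone g) (hg0 : ∀ m, 0 ≤ g m) (hgA : ∀ m, g m ≤ A)
    (n p : ℕ) :
    ∑ k ∈ Finset.range n, |g ((p : ℤ) - k).natAbs - g (((p + 1 : ℕ) : ℤ) - k).natAbs| ≤ 2 * A := by
  set H : ℕ → ℝ := fun k => if k ≤ p + 1 then g (p + 1 - k) else 2 * g 0 - g (k - (p + 1)) with hH
  have hdiff : ∀ k : ℕ, |g ((p : ℤ) - k).natAbs - g (((p + 1 : ℕ) : ℤ) - k).natAbs| =
      H (k + 1) - H k := by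
    intro k
    rcases le_or_gt k p with hk | hk
    · have e1 : ((p : ℤ) - k).natAbs = p - k := by omega
      have e2 : (((p + 1 : ℕ) : ℤ) - k).natAbs = p + 1 - k := by omega
      have e3 : p + 1 - (k + 1) = p - k := by omega
      rw [e1, e2, abs_of_nonneg (sub_nonneg.2 (hg (by omega)))]
      simp only [hH, if_pos (show k + 1 ≤ p + 1 by omega), if_pos (show k ≤ p + 1 by omega), e3]
    · have e1 : ((p : ℤ) - k).natAbs = k - p := by omega
      have e2 : (((p + 1 : ℕ) : ℤ) - k).natAbs = k - (p + 1) := by omega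
      have e3 : k + 1 - (p + 1) = k - p := by omega
      rw [e1, e2, abs_of_nonpos (sub_nonpos.2 (hg (by omega)))]
      simp only [hH, if_neg (show ¬ k + 1 ≤ p + 1 by omega), e3]
      split_ifs with hk'
      · have e4 : k - (p + 1) = 0 := by omega
        have e5 : p + 1 - k = 0 := by omega
        rw [e4, e5]
        ring
      · ring
  rw [Finset.sum_congr rfl fun k _ => hdiff k, Finset.sum_range_sub]
  have h1 : H n ≤ 2 * A := by
    simp only [hH]
    have := hg0 0
    have := hgA 0
    split_ifs
    · have := hgA (p + 1 - n)
      linarith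
    · have := hg0 (n - (p + 1))
      linarith
  have h2 : 0 ≤ H 0 := by simp [hH, hg0]
  linarith

/-- Each difference is at most `A` in absolute value, so the `ℓ¹` bound gives the `ℓ²` bound. This
is the source of `δ = √2 A`. -/
theorem sum_sq_sub_shift_le (hg : Antitone g) (hg0 : ∀ m, 0 ≤ g m) (hgA : ∀ m, g m ≤ A)
    (n p : ℕ) :
    ∑ k ∈ Finset.range n, (g ((p : ℤ) - k).natAbs - g (((p + 1 : ℕ) : ℤ) - k).natAbs) ^ 2 ≤
      2 * A ^ 2 := by
  have hA : 0 ≤ A := (hg0 0).trans (hgA 0)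
  have h1 := mul_le_mul_of_nonneg_left (sum_abs_sub_shift_le hg hg0 hgA n p) hA
  rw [Finset.mul_sum] at h1
  refine (Finset.sum_le_sum fun k _ => ?_).trans (h1.trans_eq (by ring))
  rw [← sq_abs, sq]
  refine mul_le_mul_of_nonneg_right (abs_le.2 ?_) (abs_nonneg _)
  constructor <;> linarith [hg0 ((p : ℤ) - k).natAbs, hgA ((p : ℤ) - k).natAbs,
    hg0 (((p + 1 : ℕ) : ℤ) - k).natAbs, hgA (((p + 1 : ℕ) : ℤ) - k).natAbs]

/-- The two sides of the diagonal are each summed outwards from the diagonal, which is thus counted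
twice. Row sums become partial sums of `ψ` with lengths adding up to `n + 1`. -/
theorem sum_natAbs_sub_eq (ψ : ℕ → ℝ) {n p : ℕ} (hp : p ≤ n) :
    ∑ k ∈ Finset.range n, ψ ((p : ℤ) - k).natAbs =
      ∑ i ∈ Finset.range (p + 1), ψ i + ∑ i ∈ Finset.range (n - p), ψ i - ψ 0 := by
  induction n, hp using Nat.le_induction with
  | base =>
    rw [Finset.sum_range_succ', Nat.sub_self, Finset.sum_range_zero,
      ← Finset.sum_range_reflect (fun i => ψ (i + 1))]
    simp only [add_zero, add_sub_cancel_right]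
    refine Finset.sum_congr rfl fun k hk => ?_
    rw [Finset.mem_range] at hk
    congr 1
    omega
  | succ n hn ih =>
    have e : ((p : ℤ) - n).natAbs = n - p := by omega
    rw [Finset.sum_range_succ, ih, Nat.succ_sub hn, Finset.sum_range_succ ψ (n - p), e]
    ring

theorem partialSum_concave {ψ : ℕ → ℝ} (hψ : Antitone ψ) {a d : ℕ} (had : a ≤ d) (t : ℕ) :
    ∑ i ∈ Finset.range a, ψ i + ∑ i ∈ Finset.range (d + t), ψ i ≤
      ∑ i ∈ Finset.range (a + t), ψ i + ∑ i ∈ Finset.range d, ψ i := by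
  rw [Finset.sum_range_add, Finset.sum_range_add]
  have : ∑ i ∈ Finset.range t, ψ (d + i) ≤ ∑ i ∈ Finset.range t, ψ (a + i) :=
    Finset.sum_le_sum fun i _ => hψ (by omega)
  linarith

/-- The row sums of all antitone functions of the distance to the diagonal are ordered alike. -/
theorem rowSums_comparable {n p q : ℕ} (hp : p < n) (hq : q < n) :
    (∀ ψ : ℕ → ℝ, Antitone ψ → ∑ k ∈ Finset.range n, ψ ((p : ℤ) - k).natAbs ≤
      ∑ k ∈ Finset.range n, ψ ((q : ℤ) - k).natAbs) ∨
    (∀ ψ : ℕ → ℝ, Antitone ψ → ∑ k ∈ Finset.range n, ψ ((q : ℤ) - k).natAbs ≤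
      ∑ k ∈ Finset.range n, ψ ((p : ℤ) - k).natAbs) := by
  wlog hpq : p ≤ q generalizing p q
  · exact (this hq hp (le_of_not_ge hpq)).symm
  obtain ⟨t, rfl⟩ := Nat.exists_eq_add_of_le hpq
  have e1 : n - p = n - (p + t) + t := by omega
  have e2 : p + t + 1 = p + 1 + t := by omega
  -- Partial sums are concave, so the row with the more balanced lengths has the larger sum. Which
  -- row that is depends on the indices only, not on `ψ`.
  rcases le_total (p + 1) (n - (p + t)) with h | h
  · refine Or.inl fun ψ hψ => ?_
    have := partialSum_concave hψ h t
    rw [sum_natAbs_sub_eq ψ hp.le, sum_natAbs_sub_eq ψ hq.le, e1, e2]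
    linarith
  · refine Or.inr fun ψ hψ => ?_
    have := partialSum_concave hψ h t
    rw [sum_natAbs_sub_eq ψ hp.le, sum_natAbs_sub_eq ψ hq.le, e1, e2]
    linarith

/-- Both `x²` and `2 A x - x²` are nondecreasing on `[0, A]`, so by comparability the row sums of `g
^ 2` and of `2 A g - g ^ 2` change in the same direction. The change of the former is thus at most
`2 A` times that of `g`. -/
theorem abs_sum_sq_sub_le (hg : Antitone g) (hg0 : ∀ m, 0 ≤ g m) (hgA : ∀ m, g m ≤ A)
    {n p q : ℕ} (hp : p < n) (hq : q < n) :
    |∑ k ∈ Finset.range n, g ((p : ℤ) - k).natAbs ^ 2 -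
        ∑ k ∈ Finset.range n, g ((q : ℤ) - k).natAbs ^ 2| ≤
      2 * A * |∑ k ∈ Finset.range n, g ((p : ℤ) - k).natAbs -
        ∑ k ∈ Finset.range n, g ((q : ℤ) - k).natAbs| := by
  have hA : 0 ≤ A := (hg0 0).trans (hgA 0)
  have h1 : Antitone fun m => g m ^ 2 := fun a b hab => pow_le_pow_left₀ (hg0 b) (hg hab) 2
  have h2 : Antitone fun m => 2 * A * g m - g m ^ 2 := fun a b hab => by
    have e1 := hg hab
    have e2 := hgA a
    have e3 := hgA b
    change 2 * A * g b - g b ^ 2 ≤ 2 * A * g a - g a ^ 2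
    nlinarith
  have hsum : ∀ p : ℕ, ∑ k ∈ Finset.range n, (2 * A * g ((p : ℤ) - k).natAbs -
      g ((p : ℤ) - k).natAbs ^ 2) = 2 * A * ∑ k ∈ Finset.range n, g ((p : ℤ) - k).natAbs -
      ∑ k ∈ Finset.range n, g ((p : ℤ) - k).natAbs ^ 2 := fun p => by
    rw [Finset.sum_sub_distrib, Finset.mul_sum]
  rw [← abs_of_nonneg (show 0 ≤ 2 * A by linarith), ← abs_mul]
  rcases rowSums_comparable hp hq with h | h
  · have e1 := h _ h1
    have e2 := h _ h2
    rw [hsum, hsum] at e2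
    beta_reduce at e1
    rw [abs_sub_comm, abs_of_nonneg (by linarith), ← abs_neg]
    exact le_trans (by linarith) (le_abs_self _)
  · have e1 := h _ h1
    have e2 := h _ h2
    rw [hsum, hsum] at e2
    beta_reduce at e1
    rw [abs_of_nonneg (by linarith)]
    exact le_trans (by linarith) (le_abs_self _)

theorem abs_rowSum_sub_succ_le (hg0 : ∀ m, 0 ≤ g m) (hgA : ∀ m, g m ≤ A) {n p : ℕ}
    (hp : p + 1 < n) :
    |∑ k ∈ Finset.range n, g ((p : ℤ) - k).natAbs -
      ∑ k ∈ Finset.range n, g (((p + 1 : ℕ) : ℤ) - k).natAbs| ≤ A := by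
  have e : n - p = n - (p + 1) + 1 := by omega
  rw [sum_natAbs_sub_eq g (by omega), sum_natAbs_sub_eq g hp.le, e, Finset.sum_range_succ g (p + 1),
    Finset.sum_range_succ g (n - (p + 1)), abs_le]
  constructor <;> linarith [hg0 (p + 1), hgA (p + 1), hg0 (n - (p + 1)), hgA (n - (p + 1))]

/-- Distances between rows are monotone up to a factor `√2`. -/
theorem sum_sq_sub_le_two_mul (hg : Antitone g) {n p q r : ℕ} (hpq : p ≤ q) (hqr : q ≤ r)
    (hr : r < n) :
    ∑ k ∈ Finset.range n, (g ((p : ℤ) - k).natAbs - g ((q : ℤ) - k).natAbs) ^ 2 ≤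
      2 * ∑ k ∈ Finset.range n, (g ((p : ℤ) - k).natAbs - g ((r : ℤ) - k).natAbs) ^ 2 := by
  set Γ : ℕ → ℝ := fun k => (g ((p : ℤ) - k).natAbs - g ((r : ℤ) - k).natAbs) ^ 2 with hΓ
  have hΓ0 : ∀ k, 0 ≤ Γ k := fun k => sq_nonneg _
  have sq_le : ∀ {a b c : ℝ}, c ≤ b → b ≤ a → (a - b) ^ 2 ≤ (a - c) ^ 2 := fun h1 h2 =>
    pow_le_pow_left₀ (by linarith) (by linarith) 2
  -- The pointwise comparison can fail only for `k` nearer to `q` than to both `p` and `r`. Such a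
  -- `k` is reflected in the midpoint of `q, r` if `k > q`, and in that of `p, q` otherwise: its
  -- distance to `q` becomes the distance of `f k` to `r` or `p`. As `f` is injective there, each
  -- part of the split sum costs one copy of the right side.
  set f : ℕ → ℕ := fun k => if q < k then q + r - k else p + q - k with hf
  rw [← Finset.sum_filter_add_sum_filter_not _ (fun k => p + q < 2 * k ∧ 2 * k < q + r), two_mul]
  refine add_le_add ?_ ?_
  · calc _ ≤ ∑ k ∈ (Finset.range n).filter (fun k => p + q < 2 * k ∧ 2 * k < q + r), Γ (f k) := by
          refine Finset.sum_le_sum fun k hk => ?_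
          simp only [Finset.mem_filter, Finset.mem_range] at hk
          simp only [hf, hΓ]
          split_ifs with hqk
          · have e : ((r : ℤ) - ((q + r - k : ℕ) : ℤ)).natAbs = ((q : ℤ) - k).natAbs := by omega
            rw [e, sub_sq_comm, sub_sq_comm (g ((p : ℤ) - ((q + r - k : ℕ) : ℤ)).natAbs)]
            exact sq_le (hg (by omega)) (hg (by omega))
          · have e : ((p : ℤ) - ((p + q - k : ℕ) : ℤ)).natAbs = ((q : ℤ) - k).natAbs := by omega
            rw [e, sub_sq_comm]
            exact sq_le (hg (by omega)) (hg (by omega))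
      _ = ∑ k ∈ ((Finset.range n).filter
            (fun k => p + q < 2 * k ∧ 2 * k < q + r)).image f, Γ k := by
          refine (Finset.sum_image fun a ha b hb hab => ?_).symm
          simp only [Finset.coe_filter, Finset.mem_range, Set.mem_ofPred_eq] at ha hb
          simp only [hf] at hab
          split_ifs at hab <;> omega
      _ ≤ _ := by
          refine Finset.sum_le_sum_of_subset_of_nonneg (fun k hk => ?_) fun k _ _ => hΓ0 k
          simp only [Finset.mem_image, Finset.mem_filter, Finset.mem_range] at hk ⊢
          obtain ⟨a, ha, rfl⟩ := hk
          simp only [hf]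
          split_ifs <;> omega
  · calc _ ≤ ∑ k ∈ (Finset.range n).filter (fun k => ¬ (p + q < 2 * k ∧ 2 * k < q + r)), Γ k := by
          refine Finset.sum_le_sum fun k hk => ?_
          simp only [Finset.mem_filter, Finset.mem_range] at hk
          simp only [hΓ]
          rcases le_or_gt (2 * k) (p + q) with h | h
          · exact sq_le (hg (by omega)) (hg (by omega))
          · have e1 : g ((p : ℤ) - k).natAbs ≤ g ((q : ℤ) - k).natAbs := hg (by omega)
            have e2 : g ((q : ℤ) - k).natAbs ≤ g ((r : ℤ) - k).natAbs := hg (by omega)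
            rw [sub_sq_comm, sub_sq_comm (g ((p : ℤ) - k).natAbs)]
            exact pow_le_pow_left₀ (by linarith) (by linarith) 2
      _ ≤ _ := Finset.sum_le_sum_of_subset_of_nonneg (Finset.filter_subset _ _) fun k _ _ => hΓ0 k

end Profile

/-! ### Distances between the rows of a Toeplitz matrix. -/

/-- The Euclidean distance between two rows. -/
noncomputable def rowDist {n : ℕ} (M : Matrix (Fin n) (Fin n) ℝ) (i j : Fin n) : ℝ :=
  dist (WithLp.toLp 2 (M i)) (WithLp.toLp 2 (M j))

theorem rowDist_sq {n : ℕ} (M : Matrix (Fin n) (Fin n) ℝ) (i j : Fin n) :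
    rowDist M i j ^ 2 = ∑ k, (M i k - M j k) ^ 2 := by
  rw [rowDist, EuclideanSpace.dist_eq, Real.sq_sqrt (Finset.sum_nonneg fun _ _ => sq_nonneg _)]
  simp only [Real.dist_eq, sq_abs]

theorem rowDist_eq_sqrt {n : ℕ} (M : Matrix (Fin n) (Fin n) ℝ) (i j : Fin n) :
    rowDist M i j = Real.sqrt (∑ k, (M i k - M j k) ^ 2) := by
  rw [← rowDist_sq, Real.sqrt_sq (by exact dist_nonneg)]

theorem toeplitz_rev {n : ℕ} (θ : Fin n → ℝ) (i j : Fin n) :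
    toeplitz θ i.rev j.rev = toeplitz θ i j := by
  simp only [toeplitz, Matrix.of_apply, Fin.val_rev]
  congr 2
  omega

theorem toeplitz_comm {n : ℕ} (θ : Fin n → ℝ) (i j : Fin n) :
    toeplitz θ i j = toeplitz θ j i := by
  simp only [toeplitz, Matrix.of_apply]
  congr 2
  omega

/-- The profile of a Toeplitz matrix, continued by `0`. -/
noncomputable def profile {n : ℕ} (θ : Fin n → ℝ) (m : ℕ) : ℝ :=
  if h : m < n then θ ⟨m, h⟩ else 0

section Toeplitz

variable {n : ℕ} {θ : Fin n → ℝ} {A : ℝ}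

theorem toeplitz_eq_profile (i j : Fin n) :
    toeplitz θ i j = profile θ ((i : ℤ) - ((j : ℕ) : ℤ)).natAbs := by
  rw [toeplitz, Matrix.of_apply, profile, dif_pos]

theorem sum_toeplitz_row (F : ℝ → ℝ) (i : Fin n) :
    ∑ k, F (toeplitz θ i k) = ∑ k ∈ Finset.range n, F (profile θ ((i : ℤ) - k).natAbs) := by
  simp only [toeplitz_eq_profile]
  exact Fin.sum_univ_eq_sum_range (fun k => F (profile θ ((i : ℤ) - k).natAbs)) n

theorem rowDist_toeplitz_sq (i j : Fin n) :
    rowDist (toeplitz θ) i j ^ 2 = ∑ k ∈ Finset.range n,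
      (profile θ ((i : ℤ) - k).natAbs - profile θ ((j : ℤ) - k).natAbs) ^ 2 := by
  simp only [rowDist_sq, toeplitz_eq_profile]
  exact Fin.sum_univ_eq_sum_range (fun k => (profile θ ((i : ℤ) - k).natAbs -
    profile θ ((j : ℤ) - k).natAbs) ^ 2) n

theorem profile_antitone (hθ : Antitone θ) (h0 : ∀ i, 0 ≤ θ i) : Antitone (profile θ) := by
  intro a b hab
  simp only [profile]
  split_ifs with h1 h2
  · exact hθ (by simpa using hab)
  · omega
  · exact h0 _
  · exact le_rfl

theorem profile_nonneg (h0 : ∀ i, 0 ≤ θ i) (m : ℕ) : 0 ≤ profile θ m := by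
  simp only [profile]
  split_ifs
  exacts [h0 _, le_rfl]

theorem profile_le (hA : 0 ≤ A) (hθA : ∀ i, θ i ≤ A) (m : ℕ) : profile θ m ≤ A := by
  simp only [profile]
  split_ifs
  exacts [hθA _, hA]

theorem isSeriated_toeplitz (hA : 0 ≤ A) (hθ : Antitone θ) (hθA : ∀ i, θ i ∈ Set.Icc 0 A)
    (pos : Equiv.Perm (Fin n)) :
    IsSeriated pos (fun i j => rowDist (toeplitz θ) (pos i) (pos j)) (Real.sqrt 2)
      (Real.sqrt 2 * A) := by
  have hg := profile_antitone hθ fun i => (hθA i).1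
  have hg0 := profile_nonneg fun i => (hθA i).1
  have hgA := profile_le hA fun i => (hθA i).2
  have left : ∀ i j k : Fin n, i ≤ j → j ≤ k →
      rowDist (toeplitz θ) i j ≤ Real.sqrt 2 * rowDist (toeplitz θ) i k := by
    intro i j k hij hjk
    refine le_of_sq_le_sq ?_ (mul_nonneg (Real.sqrt_nonneg _) dist_nonneg)
    rw [mul_pow, Real.sq_sqrt (by norm_num), rowDist_toeplitz_sq, rowDist_toeplitz_sq]
    exact sum_sq_sub_le_two_mul hg hij hjk k.isLt
  have hrev : ∀ i j : Fin n, rowDist (toeplitz θ) i.rev j.rev = rowDist (toeplitz θ) i j := by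
    intro i j
    rw [rowDist_eq_sqrt, rowDist_eq_sqrt, ← Equiv.sum_comp Fin.revPerm]
    simp only [Fin.revPerm_apply, toeplitz_rev]
  refine ⟨fun i => dist_self _, fun i j => dist_comm _ _, fun i j k => dist_triangle _ _ _,
    fun i j hij => ?_, fun i j k => left _ _ _, fun i j k hij hjk => ?_⟩
  · refine le_of_sq_le_sq ?_ (mul_nonneg (Real.sqrt_nonneg _) hA)
    rw [mul_pow, Real.sq_sqrt (by norm_num), rowDist_toeplitz_sq, hij]
    exact sum_sq_sub_shift_le hg hg0 hgA n (pos i)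
  · have := left (pos k).rev (pos j).rev (pos i).rev (Fin.rev_le_rev.2 hjk) (Fin.rev_le_rev.2 hij)
    rw [hrev, hrev] at this
    rw [rowDist, dist_comm, rowDist, dist_comm (WithLp.toLp 2 (toeplitz θ (pos i)))]
    exact this

theorem toeplitz_abs_sum_sq_sub_le (hA : 0 ≤ A) (hθ : Antitone θ)
    (hθA : ∀ i, θ i ∈ Set.Icc 0 A) (i j : Fin n) :
    |∑ k, toeplitz θ i k ^ 2 - ∑ k, toeplitz θ j k ^ 2| ≤
      2 * A * |∑ k, toeplitz θ i k - ∑ k, toeplitz θ j k| := by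
  rw [sum_toeplitz_row (· ^ 2), sum_toeplitz_row (· ^ 2), sum_toeplitz_row (fun x => x),
    sum_toeplitz_row (fun x => x)]
  exact abs_sum_sq_sub_le (profile_antitone hθ fun i => (hθA i).1)
    (profile_nonneg fun i => (hθA i).1) (profile_le hA fun i => (hθA i).2) i.isLt j.isLt

theorem toeplitz_abs_rowSum_sub_succ_le (hA : 0 ≤ A) (hθA : ∀ i, θ i ∈ Set.Icc 0 A) {i j : Fin n} (hij : (j : ℕ) = i + 1) :
    |∑ k, toeplitz θ i k - ∑ k, toeplitz θ j k| ≤ A := by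
  rw [sum_toeplitz_row (fun x => x), sum_toeplitz_row (fun x => x), hij]
  exact abs_rowSum_sub_succ_le (profile_nonneg fun i => (hθA i).1)
    (profile_le hA fun i => (hθA i).2) (hij ▸ j.isLt)

end Toeplitz

/-! ## The loss -/

/-- Permute the rows first, then the columns; by symmetry both moves cost `n η²`, and `(x + y)² ≤ 2
x² + 2 y²` combines them. -/
theorem sum_sq_sub_perm_le {n : ℕ} {X : Matrix (Fin n) (Fin n) ℝ} (hX : ∀ i j, X i j = X j i)
    (e : Equiv.Perm (Fin n)) {η : ℝ} (he : ∀ i, rowDist X i (e i) ≤ η) :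
    ∑ i, ∑ j, (X i j - X (e i) (e j)) ^ 2 ≤ 4 * n * η ^ 2 := by
  have hrow : ∀ i, ∑ j, (X i j - X (e i) j) ^ 2 ≤ η ^ 2 := fun i => by
    rw [← rowDist_sq]
    exact pow_le_pow_left₀ dist_nonneg (he i) 2
  have hsum : ∑ i, ∑ j, (X i j - X (e i) j) ^ 2 ≤ n * η ^ 2 := by
    simpa using Finset.sum_le_sum fun i (_ : i ∈ Finset.univ) => hrow i
  have hsum' : ∑ i, ∑ j, (X (e i) j - X (e i) (e j)) ^ 2 =
      ∑ i, ∑ j, (X i j - X (e i) j) ^ 2 := by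
    rw [Equiv.sum_comp e (fun i => ∑ j, (X i j - X i (e j)) ^ 2), Finset.sum_comm]
    exact Finset.sum_congr rfl fun j _ => Finset.sum_congr rfl fun i _ => by
      rw [hX i j, hX i (e j)]
  calc _ ≤ ∑ i, ∑ j, (2 * (X i j - X (e i) j) ^ 2 + 2 * (X (e i) j - X (e i) (e j)) ^ 2) :=
        Finset.sum_le_sum fun i _ => Finset.sum_le_sum fun j _ => by
          nlinarith [sq_nonneg ((X i j - X (e i) j) - (X (e i) j - X (e i) (e j)))]
    _ = 2 * ∑ i, ∑ j, (X i j - X (e i) j) ^ 2 +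
          2 * ∑ i, ∑ j, (X (e i) j - X (e i) (e j)) ^ 2 := by
        simp only [Finset.sum_add_distrib, Finset.mul_sum]
    _ ≤ _ := by
        rw [hsum']
        linarith

theorem frobNorm_permAct_sub_le {n : ℕ} {X T : Matrix (Fin n) (Fin n) ℝ}
    {pos p : Equiv.Perm (Fin n)} (hX : ∀ i j, X i j = T (pos i) (pos j))
    (hT : ∀ i j, T i j = T j i) {η : ℝ} (hη : 0 ≤ η)
    (h : ∀ i, rowDist X i (pos.symm (p i)) ≤ η) :
    frobNorm (permAct p X - T) ≤ 2 * Real.sqrt n * η := by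
  have hsum : ∑ i, ∑ j, (permAct p X - T) i j ^ 2 =
      ∑ i, ∑ j, (X i j - X (p.trans pos.symm i) (p.trans pos.symm j)) ^ 2 := by
    rw [← Equiv.sum_comp p]
    refine Finset.sum_congr rfl fun i _ => ?_
    rw [← Equiv.sum_comp p]
    refine Finset.sum_congr rfl fun j _ => ?_
    simp [permAct, hX]
  rw [frobNorm, hsum]
  refine Real.sqrt_le_iff.2 ⟨by positivity, ?_⟩
  have := sum_sq_sub_perm_le (fun i j => by rw [hX, hX, hT]) (p.trans pos.symm) h
  rw [mul_pow, mul_pow, Real.sq_sqrt (Nat.cast_nonneg n)]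
  linarith

/-! ## Concentration of the noise -/

/-- The expectation of `exp (g² / 8)` for a standard Gaussian `g`. -/
noncomputable def gaussianExpSq : ℝ := ∫ x, Real.exp (x ^ 2 / 8) ∂(gaussianReal 0 1)

theorem integrable_exp_sq_gaussianReal :
    Integrable (fun x => Real.exp (x ^ 2 / 8)) (gaussianReal 0 1) := by
  rw [gaussianReal_of_var_ne_zero 0 one_ne_zero, integrable_withDensity_iff_integrable_smul'
    (measurable_gaussianPDF 0 1) (ae_of_all _ fun x => gaussianPDF_lt_top)]
  -- Against the Gaussian density the exponent is `1/8 - 1/2 = -3/8`.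
  have h := (integrable_exp_neg_mul_sq (b := 3 / 8) (by norm_num)).const_mul
    (Real.sqrt (2 * Real.pi * (1 : ℝ≥0)))⁻¹
  refine h.congr (ae_of_all _ fun x => ?_)
  simp only [toReal_gaussianPDF, gaussianPDFReal, smul_eq_mul]
  rw [mul_assoc _ (Real.exp _) (Real.exp _), ← Real.exp_add]
  congr 2
  simp
  ring

theorem one_le_gaussianExpSq : 1 ≤ gaussianExpSq := by
  have h := integral_mono (integrable_const (1 : ℝ)) integrable_exp_sq_gaussianReal
    (fun x => Real.one_le_exp (by positivity))
  simpa [gaussianExpSq] using h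

theorem lintegral_exp_mul_gaussianReal (t : ℝ) :
    ∫⁻ g, ENNReal.ofReal (Real.exp (t * g)) ∂(gaussianReal 0 1) =
      ENNReal.ofReal (Real.exp (t ^ 2 / 2)) := by
  rw [← ofReal_integral_eq_lintegral_ofReal (integrable_exp_mul_gaussianReal t)
    (ae_of_all _ fun _ => (Real.exp_pos _).le)]
  have := congrFun (mgf_fun_id_gaussianReal (μ := 0) (v := 1)) t
  simp only [mgf] at this
  rw [this]
  simp

section Subgaussian

variable {Ω : Type*} [MeasurableSpace Ω] {P : Measure Ω}

theorem ProbabilityTheory.HasSubgaussianMGF.lintegral_exp_mul_le {X : Ω → ℝ} {c : ℝ≥0}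
    (hX : HasSubgaussianMGF X c P) (t : ℝ) :
    ∫⁻ ω, ENNReal.ofReal (Real.exp (t * X ω)) ∂P ≤ ENNReal.ofReal (Real.exp (c * t ^ 2 / 2)) := by
  rw [← ofReal_integral_eq_lintegral_ofReal (hX.integrable_exp_mul t)
    (ae_of_all _ fun _ => (Real.exp_pos _).le)]
  exact ENNReal.ofReal_le_ofReal (hX.mgf_le t)

theorem measure_ge_le_exp_mul_lintegral {Z : Ω → ℝ} (hZ : Measurable Z) (t : ℝ) {s : ℝ}
    (hs : 0 ≤ s) : P {ω | t ≤ Z ω} ≤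
      ENNReal.ofReal (Real.exp (-(s * t))) * ∫⁻ ω, ENNReal.ofReal (Real.exp (s * Z ω)) ∂P := by
  rw [← lintegral_const_mul _ (by fun_prop)]
  refine le_trans (measure_mono fun ω hω => ?_) (meas_le_lintegral₀ (s :=
    {ω | t ≤ Z ω}) (by fun_prop) fun ω hω => ?_)
  · exact hω
  · rw [← ENNReal.ofReal_mul (Real.exp_pos _).le, ← Real.exp_add, ← ENNReal.ofReal_one]
    refine ENNReal.ofReal_le_ofReal (Real.one_le_exp ?_)
    have : s * t ≤ s * Z ω := mul_le_mul_of_nonneg_left hω hs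
    linarith

variable [IsProbabilityMeasure P]

/-- Gaussian linearisation: `exp (X² / 8)` is the mean of `exp (X g / 2)` over a standard Gaussian
`g`. After Tonelli, the subgaussian bound at `t = g / 2` gives `exp (g² / 8)`. -/
theorem lintegral_exp_sq_le {X : Ω → ℝ} (hm : Measurable X) (hX : HasSubgaussianMGF X 1 P) :
    ∫⁻ ω, ENNReal.ofReal (Real.exp (X ω ^ 2 / 8)) ∂P ≤ ENNReal.ofReal gaussianExpSq := by
  have h1 : ∀ ω, ENNReal.ofReal (Real.exp (X ω ^ 2 / 8)) =
      ∫⁻ g, ENNReal.ofReal (Real.exp (X ω / 2 * g)) ∂(gaussianReal 0 1) := fun ω => by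
    rw [lintegral_exp_mul_gaussianReal]
    congr 2
    ring
  rw [lintegral_congr h1, lintegral_lintegral_swap (by
    refine Measurable.aemeasurable ?_
    unfold Function.uncurry
    fun_prop), gaussianExpSq, ofReal_integral_eq_lintegral_ofReal integrable_exp_sq_gaussianReal
    (ae_of_all _ fun _ => (Real.exp_pos _).le)]
  refine lintegral_mono fun g => ?_
  have h2 := hX.lintegral_exp_mul_le (g / 2)
  have h3 : ∀ ω, X ω / 2 * g = g / 2 * X ω := fun ω => by ring
  simp only [h3]
  refine h2.trans_eq ?_
  congr 2
  push_cast
  ring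

/-- Integrating out `Y` first leaves `exp (s² X² / 2)`. This is `exp` at the fraction `4 s² ≤ 1` of
`X² / 8`, so convexity between `0` and `X² / 8` produces the quadratic dependence on `s`. -/
theorem lintegral_exp_mul_mul_le {X Y : Ω → ℝ} (hXm : Measurable X) (hYm : Measurable Y)
    (hX : HasSubgaussianMGF X 1 P) (hY : HasSubgaussianMGF Y 1 P) (hXY : IndepFun X Y P) {s : ℝ}
    (hs : |s| ≤ 1 / 2) :
    ∫⁻ ω, ENNReal.ofReal (Real.exp (s * (X ω * Y ω))) ∂P ≤
      ENNReal.ofReal (Real.exp (4 * gaussianExpSq * s ^ 2)) := by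
  have hs2 : 4 * s ^ 2 ≤ 1 := by
    rw [← sq_abs]
    nlinarith [abs_nonneg s]
  have hF : Measurable fun p : ℝ × ℝ => ENNReal.ofReal (Real.exp (s * (p.1 * p.2))) := by fun_prop
  have hmap := (indepFun_iff_map_prod_eq_prod_map_map hXm.aemeasurable hYm.aemeasurable).1 hXY
  have := Measure.isProbabilityMeasure_map (μ := P) hXm.aemeasurable
  have := Measure.isProbabilityMeasure_map (μ := P) hYm.aemeasurable
  calc ∫⁻ ω, ENNReal.ofReal (Real.exp (s * (X ω * Y ω))) ∂P
      = ∫⁻ p, ENNReal.ofReal (Real.exp (s * (p.1 * p.2))) ∂((P.map X).prod (P.map Y)) := by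
        rw [← hmap, lintegral_map hF (hXm.prodMk hYm)]
    _ = ∫⁻ ω, ∫⁻ ω', ENNReal.ofReal (Real.exp (s * (X ω * Y ω'))) ∂P ∂P := by
        rw [lintegral_prod _ hF.aemeasurable, lintegral_map hF.lintegral_prod_right' hXm]
        refine lintegral_congr fun ω => ?_
        rw [lintegral_map (by fun_prop) hYm]
    _ ≤ ∫⁻ ω, (ENNReal.ofReal (1 - 4 * s ^ 2) +
          ENNReal.ofReal (4 * s ^ 2) * ENNReal.ofReal (Real.exp (X ω ^ 2 / 8))) ∂P := by
        refine lintegral_mono fun ω => ?_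
        have h1 := hY.lintegral_exp_mul_le (s * X ω)
        simp only [mul_assoc] at h1 ⊢
        refine h1.trans ?_
        rw [← ENNReal.ofReal_mul (by positivity), ← ENNReal.ofReal_add (by linarith) (by positivity)]
        refine ENNReal.ofReal_le_ofReal ?_
        have h2 := convexOn_exp.2 (Set.mem_univ 0) (Set.mem_univ (X ω ^ 2 / 8))
          (show 0 ≤ 1 - 4 * s ^ 2 by linarith) (show 0 ≤ 4 * s ^ 2 by positivity) (by ring)
        simp only [smul_eq_mul, mul_zero, zero_add, Real.exp_zero, mul_one] at h2
        refine le_trans (le_of_eq ?_) (h2.trans_eq (by ring))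
        congr 1
        push_cast
        ring
    _ ≤ ENNReal.ofReal (1 - 4 * s ^ 2) +
          ENNReal.ofReal (4 * s ^ 2) * ENNReal.ofReal gaussianExpSq := by
        rw [lintegral_add_left measurable_const, lintegral_const, measure_univ, mul_one,
          lintegral_const_mul _ (by fun_prop)]
        gcongr
        exact lintegral_exp_sq_le hXm hX
    _ ≤ ENNReal.ofReal (Real.exp (4 * gaussianExpSq * s ^ 2)) := by
        have := one_le_gaussianExpSq
        rw [← ENNReal.ofReal_mul (by positivity), ← ENNReal.ofReal_add (by linarith) (by positivity)]
        refine ENNReal.ofReal_le_ofReal (le_trans ?_ (Real.add_one_le_exp _))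
        nlinarith [sq_nonneg s]

variable {n : ℕ} {E : Ω → Matrix (Fin n) (Fin n) ℝ}

theorem lintegral_exp_mul_inner_le (hm : ∀ i j, Measurable fun ω => E ω i j)
    (hind : iIndepFun (fun (e : Fin n × Fin n) (ω : Ω) => E ω e.1 e.2) P)
    (hE : ∀ i j, HasSubgaussianMGF (fun ω => E ω i j) 1 P) {i j : Fin n} (hij : i ≠ j) {s : ℝ}
    (hs : |s| ≤ 1 / 2) (T : Finset (Fin n)) :
    ∫⁻ ω, ENNReal.ofReal (Real.exp (s * ∑ k ∈ T, E ω i k * E ω j k)) ∂P ≤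
      ENNReal.ofReal (Real.exp (T.card * (4 * gaussianExpSq * s ^ 2))) := by
  induction T using Finset.induction_on with
  | empty => simp
  | insert a T ha ih =>
    have hind2 : IndepFun (fun ω => ENNReal.ofReal (Real.exp (s * (E ω i a * E ω j a))))
        (fun ω => ENNReal.ofReal (Real.exp (s * ∑ k ∈ T, E ω i k * E ω j k))) P := by
      have h := hind.indepFun_finset (Finset.univ.filter fun e => e.2 = a)
        (Finset.univ.filter fun e => e.2 ∈ T)
        (Finset.disjoint_filter.2 fun e _ h1 h2 => ha (h1 ▸ h2)) fun e => hm e.1 e.2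
      have hφ : Measurable fun x : {e // e ∈ Finset.univ.filter
          fun e : Fin n × Fin n => e.2 = a} → ℝ => ENNReal.ofReal (Real.exp
            (s * (x ⟨(i, a), by simp⟩ * x ⟨(j, a), by simp⟩))) := by fun_prop
      have hψ : Measurable fun y : {e // e ∈ Finset.univ.filter
          fun e : Fin n × Fin n => e.2 ∈ T} → ℝ => ENNReal.ofReal (Real.exp
            (s * ∑ k ∈ T.attach, y ⟨(i, k.1), by simp⟩ * y ⟨(j, k.1), by simp⟩)) := by fun_prop
      refine (h.comp hφ hψ).congr (ae_of_all _ fun ω => rfl) (ae_of_all _ fun ω => ?_)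
      simp only [Function.comp_apply]
      rw [Finset.sum_attach T fun k => E ω i k * E ω j k]
    have hpair : IndepFun (fun ω => E ω i a) (fun ω => E ω j a) P :=
      hind.indepFun (i := (i, a)) (j := (j, a)) (by simp [hij])
    have hsplit : ∀ ω, ENNReal.ofReal (Real.exp (s * ∑ k ∈ insert a T, E ω i k * E ω j k)) =
        ENNReal.ofReal (Real.exp (s * (E ω i a * E ω j a))) *
          ENNReal.ofReal (Real.exp (s * ∑ k ∈ T, E ω i k * E ω j k)) := fun ω => by
      rw [Finset.sum_insert ha, mul_add, Real.exp_add, ENNReal.ofReal_mul (Real.exp_pos _).le]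
    rw [lintegral_congr hsplit, lintegral_mul_eq_lintegral_mul_lintegral_of_indepFun''
      (by fun_prop) (by fun_prop) hind2, Finset.card_insert_of_notMem ha]
    refine (mul_le_mul' (lintegral_exp_mul_mul_le (hm i a) (hm j a) (hE i a) (hE j a) hpair hs)
      ih).trans_eq ?_
    rw [← ENNReal.ofReal_mul (Real.exp_pos _).le, ← Real.exp_add]
    congr 2
    push_cast
    ring

theorem measure_abs_inner_ge_le (hn : 0 < n) (hm : ∀ i j, Measurable fun ω => E ω i j)
    (hind : iIndepFun (fun (e : Fin n × Fin n) (ω : Ω) => E ω e.1 e.2) P)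
    (hE : ∀ i j, HasSubgaussianMGF (fun ω => E ω i j) 1 P) {i j : Fin n} (hij : i ≠ j) :
    P {ω | (2 * gaussianExpSq + 6) * Real.sqrt (n * Real.log n) ≤ |∑ k, E ω i k * E ω j k|} ≤
      ENNReal.ofReal (2 * Real.exp (-(3 * Real.log n))) := by
  set L := Real.sqrt (n * Real.log n) with hL
  have hn0 : (0 : ℝ) < n := by exact_mod_cast hn
  have hlog : 0 ≤ Real.log n := Real.log_natCast_nonneg n
  have hL2 : L ^ 2 = n * Real.log n := Real.sq_sqrt (by positivity)
  have hL0 : 0 ≤ L := Real.sqrt_nonneg _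
  have hLn : L ≤ n := by
    refine Real.sqrt_le_iff.2 ⟨hn0.le, ?_⟩
    rw [sq]
    exact mul_le_mul_of_nonneg_left (Real.log_le_self hn0.le) hn0.le
  -- This choice is admissible as `log n ≤ n`. With `K = gaussianExpSq`, the Chernoff exponent is
  -- `-(2K + 6) s L + 4 K n s² = -(K + 3) log n + K log n = -3 log n`.
  set s := L / (2 * n) with hs
  have hs0 : 0 ≤ s := by positivity
  have hs1 : s ≤ 1 / 2 := by
    rw [hs, div_le_div_iff₀ (by positivity) (by norm_num)]
    linarith
  have hsL : s * L = Real.log n / 2 := by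
    rw [hs]
    field_simp
    linarith
  have hs2 : n * s ^ 2 = Real.log n / 4 := by
    rw [hs, div_pow, hL2]
    field_simp
    norm_num
  have one_side : ∀ σ : ℝ, |σ| = 1 → P {ω | (2 * gaussianExpSq + 6) * L ≤
      σ * ∑ k, E ω i k * E ω j k} ≤ ENNReal.ofReal (Real.exp (-(3 * Real.log n))) := by
    intro σ hσ
    have hσ2 : σ ^ 2 = 1 := by rw [← sq_abs, hσ, one_pow]
    refine (measure_ge_le_exp_mul_lintegral (by fun_prop) _ hs0).trans ?_
    have h1 := lintegral_exp_mul_inner_le hm hind hE hij (s := s * σ) (by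
      rw [abs_mul, hσ, mul_one, abs_of_nonneg hs0]
      exact hs1) Finset.univ
    simp only [mul_assoc] at h1 ⊢
    refine (mul_le_mul_right h1 _).trans ?_
    rw [← ENNReal.ofReal_mul (Real.exp_pos _).le, ← Real.exp_add, Finset.card_univ,
      Fintype.card_fin, mul_pow, hσ2]
    refine ENNReal.ofReal_le_ofReal (Real.exp_le_exp.2 (le_of_eq ?_))
    linear_combination (-(2 * gaussianExpSq + 6)) * hsL + 4 * gaussianExpSq * hs2
  have hsub : {ω | (2 * gaussianExpSq + 6) * L ≤ |∑ k, E ω i k * E ω j k|} ⊆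
      {ω | (2 * gaussianExpSq + 6) * L ≤ 1 * ∑ k, E ω i k * E ω j k} ∪
      {ω | (2 * gaussianExpSq + 6) * L ≤ (-1) * ∑ k, E ω i k * E ω j k} := by
    intro ω hω
    simpa [le_abs] using hω
  refine (measure_mono hsub).trans ((measure_union_le _ _).trans ?_)
  refine (add_le_add (one_side 1 (by simp)) (one_side (-1) (by simp))).trans_eq ?_
  rw [← ENNReal.ofReal_add (Real.exp_pos _).le (Real.exp_pos _).le, two_mul]

theorem measure_abs_weighted_sum_ge_le (hn : 0 < n)
    (hind : iIndepFun (fun (e : Fin n × Fin n) (ω : Ω) => E ω e.1 e.2) P)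
    (hE : ∀ i j, HasSubgaussianMGF (fun ω => E ω i j) 1 P) (j : Fin n) {w : Fin n → ℝ} {B : ℝ}
    (hB : 0 < B) (hw : ∀ k, |w k| ≤ B) :
    P {ω | (2 * gaussianExpSq + 6) * B * Real.sqrt (n * Real.log n) ≤ |∑ k, w k * E ω j k|} ≤
      ENNReal.ofReal (2 * Real.exp (-(3 * Real.log n))) := by
  have hn0 : (0 : ℝ) < n := by exact_mod_cast hn
  have hlog : 0 ≤ Real.log n := Real.log_natCast_nonneg n
  have hK := one_le_gaussianExpSq
  have hindj : iIndepFun (fun k ω => w k * E ω j k) P :=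
    (hind.precomp (g := fun k => (j, k)) (fun a b hab => by simpa using hab)).comp
      (fun k x => w k * x) (fun k => by fun_prop)
  have hsub := HasSubgaussianMGF.sum_of_iIndepFun hindj (s := Finset.univ)
    (fun k _ => (hE j k).const_mul (w k))
  have hsub' : HasSubgaussianMGF (fun ω => ∑ k, w k * E ω j k) (Real.toNNReal (n * B ^ 2)) P := by
    refine ⟨hsub.integrable_exp_mul, fun t => (hsub.mgf_le t).trans (Real.exp_le_exp.2 ?_)⟩
    rw [Real.coe_toNNReal _ (by positivity)]
    refine (le_of_eq (congrArg (fun c : ℝ => c * t ^ 2 / 2) ((NNReal.coe_sum _ _).trans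
      (Finset.sum_congr rfl fun k _ => mul_one (w k ^ 2))))).trans ?_
    have : ∑ k, w k ^ 2 ≤ n * B ^ 2 := by
      simpa using Finset.sum_le_sum fun k (_ : k ∈ Finset.univ) =>
        sq_le_sq' (abs_le.1 (hw k)).1 (abs_le.1 (hw k)).2
    have h2 := mul_le_mul_of_nonneg_right this (sq_nonneg t)
    linarith
  have one_side : ∀ {Z : Ω → ℝ}, HasSubgaussianMGF Z (Real.toNNReal (n * B ^ 2)) P →
      P {ω | (2 * gaussianExpSq + 6) * B * Real.sqrt (n * Real.log n) ≤ Z ω} ≤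
        ENNReal.ofReal (Real.exp (-(3 * Real.log n))) := by
    intro Z hZ
    have h1 := hZ.measure_ge_le
      (ε := (2 * gaussianExpSq + 6) * B * Real.sqrt (n * Real.log n)) (by positivity)
    rw [← ENNReal.ofReal_toReal (measure_ne_top P _)]
    refine ENNReal.ofReal_le_ofReal (h1.trans (Real.exp_le_exp.2 ?_))
    rw [Real.coe_toNNReal _ (by positivity), mul_pow, Real.sq_sqrt (by positivity), neg_div,
      neg_le_neg_iff, le_div_iff₀ (by positivity)]
    have h3 : 6 ≤ (2 * gaussianExpSq + 6) ^ 2 := by nlinarith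
    have h4 := mul_le_mul_of_nonneg_right h3 (show 0 ≤ B ^ 2 * (n * Real.log n) by positivity)
    linarith
  have hsubset : {ω | (2 * gaussianExpSq + 6) * B * Real.sqrt (n * Real.log n) ≤
      |∑ k, w k * E ω j k|} ⊆
      {ω | (2 * gaussianExpSq + 6) * B * Real.sqrt (n * Real.log n) ≤ ∑ k, w k * E ω j k} ∪
      {ω | (2 * gaussianExpSq + 6) * B * Real.sqrt (n * Real.log n) ≤
        (-fun ω => ∑ k, w k * E ω j k) ω} := by
    intro ω hω
    simpa [le_abs] using hω
  refine (measure_mono hsubset).trans ((measure_union_le _ _).trans ?_)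
  refine (add_le_add (one_side hsub') (one_side hsub'.neg)).trans_eq ?_
  rw [← ENNReal.ofReal_add (Real.exp_pos _).le (Real.exp_pos _).le, two_mul]

end Subgaussian

/-- The noise matrix `E` has small row sums, small correlations with the rows of `X` and small
correlations between its rows. -/
structure NoiseBound {n : ℕ} (a A L : ℝ) (X E : Matrix (Fin n) (Fin n) ℝ) : Prop where
  rowSum : ∀ i, |∑ k, E i k| ≤ a * L
  cross : ∀ i j, |∑ k, X i k * E j k| ≤ a * A * L
  inner : ∀ i j, i ≠ j → |∑ k, E i k * E j k| ≤ a * L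

theorem measure_not_noiseBound_le {Ω : Type*} [MeasurableSpace Ω] {P : Measure Ω}
    [IsProbabilityMeasure P] {n : ℕ} (hn : 0 < n) {E : Ω → Matrix (Fin n) (Fin n) ℝ}
    (hm : ∀ i j, Measurable fun ω => E ω i j)
    (hind : iIndepFun (fun (e : Fin n × Fin n) (ω : Ω) => E ω e.1 e.2) P)
    (hE : ∀ i j, HasSubgaussianMGF (fun ω => E ω i j) 1 P) {A : ℝ} (hA : 0 < A)
    {X : Matrix (Fin n) (Fin n) ℝ} (hX : ∀ i j, |X i j| ≤ A) :
    P {ω | ¬ NoiseBound (2 * gaussianExpSq + 6) A (Real.sqrt (n * Real.log n)) X (E ω)} ≤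
      ENNReal.ofReal (6 / n) := by
  set a := 2 * gaussianExpSq + 6 with ha
  set L := Real.sqrt (n * Real.log n) with hL
  set q := ENNReal.ofReal (2 * Real.exp (-(3 * Real.log n))) with hq
  have hn0 : (0 : ℝ) < n := by exact_mod_cast hn
  have hn1 : (1 : ℝ) ≤ n := by exact_mod_cast hn
  have hcover : {ω | ¬ NoiseBound a A L X (E ω)} ⊆
      (⋃ i : Fin n, {ω | a * 1 * L ≤ |∑ k, 1 * E ω i k|}) ∪
      ((⋃ e : Fin n × Fin n, {ω | a * A * L ≤ |∑ k, X e.1 k * E ω e.2 k|}) ∪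
        ⋃ e : Fin n × Fin n, {ω | e.1 ≠ e.2 ∧ a * L ≤ |∑ k, E ω e.1 k * E ω e.2 k|}) := by
    intro ω hω
    by_contra hcon
    simp only [Set.mem_union, Set.mem_iUnion, Set.mem_ofPred_eq, not_or, not_exists, not_le,
      not_and, one_mul, mul_one] at hcon
    exact hω ⟨fun i => (hcon.1 i).le, fun i j => (hcon.2.1 (i, j)).le,
      fun i j hij => (hcon.2.2 (i, j) hij).le⟩
  have h1 : ∀ i : Fin n, P {ω | a * 1 * L ≤ |∑ k, 1 * E ω i k|} ≤ q := fun i =>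
    measure_abs_weighted_sum_ge_le hn hind hE i one_pos (w := fun _ => 1) (by simp)
  have h2 : ∀ e : Fin n × Fin n, P {ω | a * A * L ≤ |∑ k, X e.1 k * E ω e.2 k|} ≤ q := fun e =>
    measure_abs_weighted_sum_ge_le hn hind hE e.2 hA (hX e.1)
  have h3 : ∀ e : Fin n × Fin n,
      P {ω | e.1 ≠ e.2 ∧ a * L ≤ |∑ k, E ω e.1 k * E ω e.2 k|} ≤ q := fun e => by
    by_cases he : e.1 = e.2
    · simp [he]
    · exact (measure_mono fun ω hω => hω.2).trans (measure_abs_inner_ge_le hn hm hind hE he)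
  -- Each event has probability at most `2 n⁻³` and each of the three families has at most `n²`
  -- members.
  have hsum : ∀ {ι : Type} [Fintype ι] (s : ι → Set Ω), (∀ i, P (s i) ≤ q) →
      Fintype.card ι ≤ n ^ 2 → P (⋃ i, s i) ≤ ENNReal.ofReal (2 / n) := by
    intro ι _ s hs hc
    calc P (⋃ i, s i) ≤ ∑ i, P (s i) := measure_iUnion_fintype_le _ _
      _ ≤ ∑ _i : ι, q := Finset.sum_le_sum fun i _ => hs i
      _ = (Fintype.card ι : ℝ≥0∞) * q := by simp
      _ ≤ ((n ^ 2 : ℕ) : ℝ≥0∞) * q := by gcongr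
      _ = ENNReal.ofReal (2 / n) := by
        rw [hq, ← ENNReal.ofReal_natCast, ← ENNReal.ofReal_mul (by positivity)]
        congr 1
        rw [Real.exp_neg, mul_comm 3, Real.exp_mul, Real.exp_log hn0]
        norm_cast
        push_cast
        field_simp
  refine (measure_mono hcover).trans ((measure_union_le _ _).trans
    ((add_le_add_right (measure_union_le _ _) _).trans ?_))
  refine (add_le_add (hsum _ h1 ?_) (add_le_add (hsum _ h2 ?_) (hsum _ h3 ?_))).trans_eq ?_
  · rw [Fintype.card_fin]
    nlinarith
  · simp [sq]
  · simp [sq]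
  · rw [← ENNReal.ofReal_add (by positivity) (by positivity),
      ← ENNReal.ofReal_add (by positivity) (by positivity)]
    congr 1
    ring

/-! ## Step count -/

namespace Timed

variable {n : ℕ} {α β : Type}

theorem bind_steps (x : Timed α) (f : α → Timed β) :
    (x >>= f).steps = x.steps + (f x.val).steps := rfl

theorem bind_val (x : Timed α) (f : α → Timed β) : (x >>= f).val = (f x.val).val := rfl

theorem ops_steps (k : ℕ) (a : α) : (ops k a).steps = k := rfl

theorem ops_val (k : ℕ) (a : α) : (ops k a).val = a := rfl

theorem pure_steps (a : α) : (pure a : Timed α).steps = 0 := rfl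

theorem pure_val (a : α) : (pure a : Timed α).val = a := rfl

theorem sum_steps_le {f : Fin n → Timed α} {b : ℕ} (h : ∀ i, (f i).steps ≤ b) :
    ∑ i, ((f i).steps + 1) ≤ n * (b + 1) := by
  simpa using Finset.sum_le_sum fun i (_ : i ∈ Finset.univ) => Nat.add_le_add_right (h i) 1

theorem table_steps_le {f : Fin n → Timed α} {b : ℕ} (h : ∀ i, (f i).steps ≤ b) :
    (table f).steps ≤ n * (b + 1) := sum_steps_le h

theorem sum_steps_le' {f : Fin n → Timed ℝ} {b : ℕ} (h : ∀ i, (f i).steps ≤ b) :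
    (sum f).steps ≤ n * (b + 1) := sum_steps_le h

theorem select_steps_le {f : Fin n → Timed Bool} {b : ℕ} (h : ∀ i, (f i).steps ≤ b) :
    (select f).steps ≤ n * (b + 1) := sum_steps_le h

theorem all_steps_le {f : Fin n → Timed Bool} {b : ℕ} (h : ∀ i, (f i).steps ≤ b) :
    (all f).steps ≤ n * (b + 1) := sum_steps_le h

theorem any_steps_le {f : Fin n → Timed Bool} {b : ℕ} (h : ∀ i, (f i).steps ≤ b) :
    (any f).steps ≤ n * (b + 1) := sum_steps_le h

theorem max_steps (s : Finset (Fin n)) (v : Fin n → ℝ) : (max s v).steps = n * 3 := by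
  simp [max]

end Timed

namespace Pines

open Timed

variable {n : ℕ}

theorem take_steps (ch : Choices n) (s : Stage) (t : Finset (Fin n)) :
    (take ch s t).steps = n + 1 := rfl

theorem distances_steps_le (c₁ A : ℝ) (Y : Matrix (Fin n) (Fin n) ℝ) :
    (distances c₁ A Y).steps ≤ n * (n * 2 + 1) + (n * (n * (n * 4 + 1) + 1) + (5 +
      (n * (n * 7 + n * 3 + 1) + n * (n * 11 + 1)))) := by
  simp only [distances, bind_steps]
  refine add_le_add ?_ (add_le_add ?_ (add_le_add le_rfl (add_le_add ?_ ?_)))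
  · exact table_steps_le fun i => sum_steps_le' fun j => le_rfl
  · exact table_steps_le fun i => table_steps_le fun j => sum_steps_le' fun k => le_rfl
  · refine table_steps_le fun i => ?_
    rw [bind_steps, max_steps]
    exact add_le_add (select_steps_le fun j => le_rfl) le_rfl
  · exact table_steps_le fun i => table_steps_le fun j => le_rfl

theorem packing_steps_le (ch : Choices n) (d : Fin n → Fin n → ℝ) (ρ₁ : ℝ) (m : ℕ)
    (D : Finset (Fin n)) : (packing ch d ρ₁ m D).steps ≤ (m + 1) * (8 * n + 2) := by
  induction m generalizing D with
  | zero =>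
    simp only [packing, ops_steps]
    omega
  | succ m ih =>
    rcases h : (take ch Stage.center Dᶜ).val with _ | i
    · simp only [packing, bind_steps, ops_steps, ops_val, take_steps, h]
      nlinarith
    · simp only [packing, bind_steps, ops_steps, ops_val, take_steps, h]
      have h2 := select_steps_le (n := n) (b := 3)
        (f := fun j => ops 3 (decide (j ∉ D ∧ d i j ≤ ρ₁))) fun j => le_rfl
      refine (add_le_add le_rfl (add_le_add le_rfl (add_le_add h2 (add_le_add le_rfl
        (add_le_add (ih _) le_rfl))))).trans ?_
      linarith

theorem explore_steps_le (d : Fin n → Fin n → ℝ) (ρ₂ ρ₃ : ℝ) (i : Fin n) (m : ℕ)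
    (R : Finset (Fin n)) : (explore d ρ₂ ρ₃ i m R).steps ≤ m * (n * (n * 9 + 1)) := by
  induction m generalizing R with
  | zero => simp [explore, pure_steps]
  | succ m ih =>
    simp only [explore, bind_steps]
    refine (add_le_add (select_steps_le fun v => any_steps_le (b := 8) fun u => le_rfl)
      (ih _)).trans ?_
    linarith

theorem classes_steps_le (d : Fin n → Fin n → ℝ) (ρ₂ ρ₃ : ℝ) (P : Finset (Fin n)) :
    (classes d ρ₂ ρ₃ P).steps ≤
      n * (n * (n + (n * (n * (n * 9 + 1)) + n * 4) + 1) + 1) := by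
  refine table_steps_le fun i => table_steps_le fun j => ?_
  simp only [bind_steps]
  exact add_le_add le_rfl (add_le_add (explore_steps_le _ _ _ _ _ _)
    (select_steps_le fun k => le_rfl))

theorem extremals_steps_le (P : Finset (Fin n)) (cls : Fin n → Fin n → Finset (Fin n)) :
    (extremals P cls).steps ≤ n * (n * (n * 6 + 1) + 2 + 1) := by
  refine select_steps_le fun i => ?_
  rw [bind_steps]
  exact add_le_add (all_steps_le fun j => all_steps_le fun k => le_rfl) le_rfl

theorem chain_steps_le (ch : Choices n) (P : Finset (Fin n))
    (cls : Fin n → Fin n → Finset (Fin n)) (m : ℕ) (Q : Finset (Fin n)) :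
    (chain ch P cls m Q).steps ≤ m * (n * 3 + (n * (n * (n * 3 + 5 + 1) + 1) + (n + 1 + 2))) := by
  induction m generalizing Q with
  | zero => simp [chain, pure_steps]
  | succ m ih =>
    have h1 := all_steps_le (n := n) (b := 2)
      (f := fun k => ops 2 (decide (k ∈ Q ↔ k ∈ P))) fun k => le_rfl
    have h2 := select_steps_le (n := n) (f := fun i => any fun j => do
        let b ← all fun k => ops 2 (decide (k ∈ cls i j ↔ k ∈ Q))
        ops 5 (decide (i ∈ P ∧ i ∉ Q ∧ j ∈ P ∧ j ≠ i ∧ b = true)))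
      fun i => any_steps_le (b := n * 3 + 5) fun j => by
        rw [bind_steps]
        exact add_le_add (all_steps_le fun k => le_rfl) le_rfl
    have h3 := Nat.zero_le (m * (n * 3 + (n * (n * (n * 3 + 5 + 1) + 1) + (n + 1 + 2))))
    have h4 := Nat.zero_le (n * (n * (n * 3 + 5 + 1) + 1))
    rw [chain, bind_steps]
    split_ifs
    · rw [pure_steps]
      linarith
    · rw [bind_steps, bind_steps, take_steps]
      generalize (take ch Stage.next _).val = o
      rcases o with _ | i
      · rw [pure_steps]
        linarith
      · simp only [bind_steps, ops_steps, ops_val]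
        have := ih (insert i Q)
        linarith

/-- The cost of listing the cells depends on the length of the order, so that length has to be
bounded on every input, even when the distances make no sense. -/
theorem chain_length_le (ch : Choices n) (P : Finset (Fin n))
    (cls : Fin n → Fin n → Finset (Fin n)) (m : ℕ) (Q : Finset (Fin n)) :
    ∀ l ∈ (chain ch P cls m Q).val, l.length ≤ m := by
  induction m generalizing Q with
  | zero => simp [chain, pure_val]
  | succ m ih =>
    rw [chain, bind_val]
    split_ifs
    · simp [pure_val]
    · rw [bind_val, bind_val]
      generalize (take ch Stage.next _).val = o
      rcases o with _ | i
      · simp [pure_val]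
      · intro l hl
        simp only [bind_val, ops_val, Option.mem_def, Option.map_eq_some_iff] at hl
        obtain ⟨l', hl', rfl⟩ := hl
        exact Nat.succ_le_succ (ih _ l' hl')

theorem orderPacking_steps_le (ch : Choices n) (P : Finset (Fin n))
    (cls : Fin n → Fin n → Finset (Fin n)) :
    (orderPacking ch P cls).steps ≤ n * (n * (n * 6 + 1) + 2 + 1) + (n + 1 + (n +
      (n * (n * 3 + (n * (n * (n * 3 + 5 + 1) + 1) + (n + 1 + 2))) + 1))) := by
  have h1 := extremals_steps_le P cls
  rw [orderPacking, bind_steps, bind_steps, take_steps]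
  generalize (take ch Stage.extremal _).val = o
  rcases o with _ | i
  · rw [pure_steps]
    linarith [Nat.zero_le (n * (n * 3 + (n * (n * (n * 3 + 5 + 1) + 1) + (n + 1 + 2))))]
  · simp only [bind_steps, ops_steps, ops_val]
    have := chain_steps_le ch P cls n {i}
    linarith

theorem orderPacking_length_le (ch : Choices n) (P : Finset (Fin n))
    (cls : Fin n → Fin n → Finset (Fin n)) :
    ∀ l ∈ (orderPacking ch P cls).val, l.length ≤ n + 1 := by
  rw [orderPacking, bind_val, bind_val]
  generalize (take ch Stage.extremal _).val = o
  rcases o with _ | i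
  · simp [pure_val]
  · intro l hl
    simp only [bind_val, ops_val, Option.mem_def, Option.map_eq_some_iff] at hl
    obtain ⟨l', hl', rfl⟩ := hl
    exact Nat.succ_le_succ (chain_length_le _ _ _ _ _ l' hl')

theorem listCell_steps_le (ch : Choices n) (m : ℕ) (C : Finset (Fin n)) :
    (listCell ch m C).steps ≤ m * (n + 3) ∧ (listCell ch m C).val.length ≤ m := by
  induction m generalizing C with
  | zero => simp [listCell, pure_steps, pure_val]
  | succ m ih =>
    rw [listCell, bind_steps, bind_val, take_steps]
    generalize (take ch Stage.inCell _).val = o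
    rcases o with _ | i
    · refine ⟨?_, Nat.zero_le _⟩
      rw [pure_steps]
      linarith [Nat.zero_le (m * (n + 3))]
    · simp only [bind_steps, bind_val, ops_steps, ops_val, List.length_cons]
      have := ih (C.erase i)
      refine ⟨?_, by omega⟩
      linarith

theorem listCells_steps_le (ch : Choices n) (cell : Fin n → Finset (Fin n)) (l : List (Fin n)) :
    (listCells ch cell l).steps ≤ l.length * (n * (n + 3) + n + 1) ∧
      (listCells ch cell l).val.length ≤ l.length * n := by
  induction l with
  | nil => simp [listCells, pure_steps, pure_val]
  | cons i l ih =>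
    have := listCell_steps_le ch n (cell i)
    simp only [listCells, bind_steps, bind_val, ops_steps, ops_val, List.length_cons,
      List.length_append]
    constructor <;> linarith

theorem run_steps_le (ch : Choices n) (d : Fin n → Fin n → ℝ) (ρ₁ ρ₂ ρ₃ : ℝ) :
    (run ch d ρ₁ ρ₂ ρ₃).steps ≤ 100 * (n + 1) ^ 5 := by
  have h1 := packing_steps_le ch d ρ₁ n ∅
  have h2 := classes_steps_le d ρ₂ ρ₃ (packing ch d ρ₁ n ∅).val.1
  have h3 := orderPacking_steps_le ch (packing ch d ρ₁ n ∅).val.1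
    (classes d ρ₂ ρ₃ (packing ch d ρ₁ n ∅).val.1).val
  have h4 := orderPacking_length_le ch (packing ch d ρ₁ n ∅).val.1
    (classes d ρ₂ ρ₃ (packing ch d ρ₁ n ∅).val.1).val
  simp only [run, bind_steps, ops_steps, ops_val]
  revert h3 h4
  generalize orderPacking ch _ _ = o
  intro h3 h4
  rcases ho : o.val with _ | l
  · simp only [pure_steps]
    nlinarith [Nat.zero_le (n ^ 2), Nat.zero_le (n ^ 3), Nat.zero_le (n ^ 4), Nat.zero_le (n ^ 5)]
  · have hl := h4 l ho
    obtain ⟨h5, h6⟩ := listCells_steps_le ch (packing ch d ρ₁ n ∅).val.2 l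
    simp only [bind_steps, positions, ops_steps]
    have h5' := h5.trans (Nat.mul_le_mul_right (n * (n + 3) + n + 1) hl)
    have h6' := Nat.mul_le_mul_left (n + 1)
      (Nat.add_le_add_right (h6.trans (Nat.mul_le_mul_right n hl)) 1)
    refine (add_le_add le_rfl (add_le_add h1 (add_le_add h2 (add_le_add h3
      (add_le_add h5' h6'))))).trans ?_
    ring_nf
    nlinarith [Nat.zero_le (n ^ 2), Nat.zero_le (n ^ 3), Nat.zero_le (n ^ 4), Nat.zero_le (n ^ 5)]

theorem pines_steps_le (c₁ c₂ A : ℝ) (Y : Matrix (Fin n) (Fin n) ℝ) (ch : Choices n) :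
    (pines c₁ c₂ A Y ch).steps ≤ 200 * (n + 1) ^ 5 := by
  have h1 := distances_steps_le c₁ A Y
  simp only [pines, bind_steps, ops_steps, ops_val]
  refine (add_le_add h1 (add_le_add le_rfl (add_le_add le_rfl (add_le_add le_rfl
    (add_le_add le_rfl (add_le_add le_rfl (add_le_add le_rfl
      (run_steps_le _ _ _ _ _)))))))).trans ?_
  ring_nf
  nlinarith [Nat.zero_le (n ^ 2), Nat.zero_le (n ^ 3), Nat.zero_le (n ^ 4), Nat.zero_le (n ^ 5)]

end Pines

/-! ## Accuracy of the estimated distances -/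

namespace Pines

variable {n : ℕ}

/-- Exposes `U` through what the estimate needs: it dominates every candidate and is attained by
one. A given candidate rules out the default value for an empty set. -/
theorem distances_val (c₁ A : ℝ) (Y : Matrix (Fin n) (Fin n) ℝ) : ∃ U : Fin n → ℝ,
    (∀ i j, j ≠ i →
      |∑ k, Y j k - ∑ k, Y i k| ≤ c₁ * (A + Real.sqrt (n * Real.log n)) →
      ∑ k, Y i k * Y j k ≤ U i ∧ ∃ j', j' ≠ i ∧
        |∑ k, Y j' k - ∑ k, Y i k| ≤ c₁ * (A + Real.sqrt (n * Real.log n)) ∧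
        U i = ∑ k, Y i k * Y j' k) ∧
    ∀ i j, (distances c₁ A Y).val i j =
      if i = j then 0 else Real.sqrt (U i + U j - 2 * ∑ k, Y i k * Y j k) := by
  refine ⟨fun i => (Timed.max (Timed.select fun j => Timed.ops 6 (decide (j ≠ i ∧
    |∑ k, Y j k - ∑ k, Y i k| ≤ c₁ * (A + Real.sqrt (n * Real.log n))))).val
    fun j => ∑ k, Y i k * Y j k).val, fun i j hji hj => ?_, fun i j => rfl⟩
  simp only [Timed.select, Timed.ops, Timed.max, decide_eq_true_eq]
  set N : Finset (Fin n) := Finset.univ.filter fun j => j ≠ i ∧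
    |∑ k, Y j k - ∑ k, Y i k| ≤ c₁ * (A + Real.sqrt (n * Real.log n)) with hN
  have hmem : j ∈ N := Finset.mem_filter.2 ⟨Finset.mem_univ _, hji, hj⟩
  have hne : N.Nonempty := ⟨j, hmem⟩
  rw [dif_pos hne]
  obtain ⟨j', hj', heq⟩ := Finset.exists_mem_eq_sup' hne fun j => ∑ k, Y i k * Y j k
  refine ⟨Finset.le_sup' (fun j => ∑ k, Y i k * Y j k) hmem, j', ?_, ?_, heq⟩ <;>
    simp only [hN, Finset.mem_filter] at hj'
  exacts [hj'.2.1, hj'.2.2]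

end Pines

theorem rowDist_sq_eq {n : ℕ} (M : Matrix (Fin n) (Fin n) ℝ) (i j : Fin n) :
    rowDist M i j ^ 2 = ∑ k, M i k ^ 2 + ∑ k, M j k ^ 2 - 2 * ∑ k, M i k * M j k := by
  rw [rowDist_sq, Finset.mul_sum, ← Finset.sum_add_distrib, ← Finset.sum_sub_distrib]
  exact Finset.sum_congr rfl fun k _ => by ring

/-- No lower bound on `D` is needed: when `D ≤ η` the lower estimate is trivial. A negative `x` is
allowed, its root being `0`. -/
theorem abs_sqrt_sub_le {x D η : ℝ} (hD : 0 ≤ D) (hη : 0 ≤ η) (h : |x - D ^ 2| ≤ η ^ 2) :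
    |Real.sqrt x - D| ≤ η := by
  obtain ⟨h1, h2⟩ := abs_le.1 h
  have h3 : Real.sqrt x ≤ D + η := Real.sqrt_le_iff.2 ⟨by positivity, by nlinarith⟩
  have h4 : D - η ≤ Real.sqrt x := by
    rcases le_total D η with hDη | hDη
    · linarith [Real.sqrt_nonneg x]
    · exact Real.le_sqrt_of_sq_le (by nlinarith)
  exact abs_le.2 ⟨by linarith, by linarith⟩

theorem rpow_quarter_sq {x : ℝ} (hx : 0 ≤ x) : (x ^ (1 / 4 : ℝ)) ^ 2 = Real.sqrt x := by
  rw [← Real.rpow_natCast, ← Real.rpow_mul hx, Real.sqrt_eq_rpow]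
  norm_num

section Accuracy

variable {n : ℕ} {X E : Matrix (Fin n) (Fin n) ℝ} {a A L : ℝ}

theorem NoiseBound.abs_inner_sub_le (h : NoiseBound a A L X E) (ha : 0 ≤ a) (hA : 1 ≤ A)
    (hL : 0 ≤ L) {i j : Fin n} (hij : i ≠ j) :
    |∑ k, (X + E) i k * (X + E) j k - ∑ k, X i k * X j k| ≤ 3 * a * (A * (A + L)) := by
  have hsplit : ∑ k, (X + E) i k * (X + E) j k - ∑ k, X i k * X j k =
      ∑ k, X i k * E j k + ∑ k, X j k * E i k + ∑ k, E i k * E j k := by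
    simp only [Matrix.add_apply, ← Finset.sum_add_distrib, ← Finset.sum_sub_distrib]
    exact Finset.sum_congr rfl fun k _ => by ring
  rw [hsplit]
  refine (abs_add_three _ _ _).trans ?_
  have h1 := h.cross i j
  have h2 := h.cross j i
  have h3 := h.inner i j hij
  have h4 : a * L ≤ a * A * L := by nlinarith [mul_nonneg ha hL]
  have h5 : 0 ≤ a * (A * A) := by positivity
  linarith

theorem NoiseBound.abs_rowSum_sub_le (h : NoiseBound a A L X E) (i j : Fin n) :
    |(∑ k, (X + E) i k - ∑ k, (X + E) j k) - (∑ k, X i k - ∑ k, X j k)| ≤ 2 * a * L := by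
  have hsplit : (∑ k, (X + E) i k - ∑ k, (X + E) j k) - (∑ k, X i k - ∑ k, X j k) =
      ∑ k, E i k - ∑ k, E j k := by
    simp only [Matrix.add_apply, Finset.sum_add_distrib]
    ring
  rw [hsplit]
  refine (abs_sub _ _).trans ?_
  linarith [h.rowSum i, h.rowSum j]

theorem NoiseBound.distances_accurate
    (h : NoiseBound a A (Real.sqrt (n * Real.log n)) X E) (ha : 0 ≤ a) (hA : 1 ≤ A)
    (hsq : ∀ i j, |∑ k, X i k ^ 2 - ∑ k, X j k ^ 2| ≤ 2 * A * |∑ k, X i k - ∑ k, X j k|)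
    (hnb : ∀ i, ∃ j, j ≠ i ∧ |∑ k, X i k - ∑ k, X j k| ≤ A ∧ rowDist X i j ^ 2 ≤ 2 * A ^ 2)
    (i j : Fin n) :
    |(Pines.distances (2 * a + 1) A (X + E)).val i j - rowDist X i j| ≤
      Real.sqrt (20 * a + 4) * (A + Real.sqrt A * (n * Real.log n) ^ (1 / 4 : ℝ)) := by
  have hnl : 0 ≤ n * Real.log n := mul_nonneg (Nat.cast_nonneg n) (Real.log_natCast_nonneg n)
  have hq := rpow_quarter_sq hnl
  set L := Real.sqrt (n * Real.log n) with hLdef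
  set q := (n * Real.log n) ^ (1 / 4 : ℝ) with hqdef
  have hq0 : 0 ≤ q := Real.rpow_nonneg hnl _
  have hL : 0 ≤ L := Real.sqrt_nonneg _
  have hη0 : 0 ≤ Real.sqrt (20 * a + 4) * (A + Real.sqrt A * q) := by positivity
  obtain ⟨U, hU, hval⟩ := Pines.distances_val (2 * a + 1) A (X + E)
  rw [← hLdef] at hU
  have hB : 0 ≤ A * (A + L) := by positivity
  have hAB : A ^ 2 ≤ A * (A + L) := by nlinarith
  -- Write each inner product as half of the two square norms minus the square distance. The true
  -- neighbour `j` gives the lower bound; for the maximiser `j'`, drop the square distance and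
  -- compare norms through row sums. Two such errors and twice `3 a` make the constant `20 a + 4`.
  have key : ∀ i, |U i - ∑ k, X i k ^ 2| ≤ (7 * a + 2) * (A * (A + L)) := by
    intro i
    obtain ⟨j, hji, hj1, hj2⟩ := hnb i
    have hjN : |∑ k, (X + E) j k - ∑ k, (X + E) i k| ≤ (2 * a + 1) * (A + L) := by
      have e1 := abs_le.1 (h.abs_rowSum_sub_le j i)
      rw [abs_sub_comm] at hj1
      have e2 := abs_le.1 hj1
      have e3 : 0 ≤ a * A := by positivity
      exact abs_le.2 ⟨by linarith, by linarith⟩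
    obtain ⟨hlow, j', hj'i, hj', hUj'⟩ := hU i j hji hjN
    have e1 := abs_le.1 (h.abs_inner_sub_le ha hA hL hji.symm)
    have e2 := abs_le.1 (h.abs_inner_sub_le ha hA hL hj'i.symm)
    have e3 := abs_le.1 (hsq i j)
    have e4 := abs_le.1 (hsq i j')
    have e5 := rowDist_sq_eq X i j
    have e6 := rowDist_sq_eq X i j'
    have e7 := sq_nonneg (rowDist X i j')
    have e8 : 2 * A * |∑ k, X i k - ∑ k, X j k| ≤ 2 * A * A := by gcongr
    have e9 : |∑ k, X i k - ∑ k, X j' k| ≤ (4 * a + 2) * (A + L) := by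
      have f1 := abs_le.1 (h.abs_rowSum_sub_le i j')
      rw [abs_sub_comm] at hj'
      have f2 := abs_le.1 hj'
      have f3 : 0 ≤ a * A := by positivity
      exact abs_le.2 ⟨by linarith, by linarith⟩
    have e10 : 2 * A * |∑ k, X i k - ∑ k, X j' k| ≤ 2 * A * ((4 * a + 2) * (A + L)) := by gcongr
    have e11 : 0 ≤ a * (A * (A + L)) := by positivity
    exact abs_le.2 ⟨by linarith, by linarith⟩
  rw [hval]
  split_ifs with hij
  · rw [hij, show rowDist X j j = 0 from dist_self _]
    simpa using hη0
  · refine abs_sqrt_sub_le (by exact dist_nonneg) hη0 ?_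
    have e1 := abs_le.1 (key i)
    have e2 := abs_le.1 (key j)
    have e3 := abs_le.1 (h.abs_inner_sub_le ha hA hL hij)
    have e4 := rowDist_sq_eq X i j
    have e5 : (20 * a + 4) * (A * (A + L)) ≤
        (Real.sqrt (20 * a + 4) * (A + Real.sqrt A * q)) ^ 2 := by
      rw [mul_pow, Real.sq_sqrt (by positivity)]
      refine mul_le_mul_of_nonneg_left ?_ (by positivity)
      have f1 : (Real.sqrt A * q) ^ 2 = A * L := by
        rw [mul_pow, Real.sq_sqrt (by positivity), hq]
      have f2 : 0 ≤ A * (Real.sqrt A * q) := by positivity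
      nlinarith
    exact abs_le.2 ⟨by linarith, by linarith⟩

theorem distances_comm (c₁ A : ℝ) (Y : Matrix (Fin n) (Fin n) ℝ) (i j : Fin n) :
    (Pines.distances c₁ A Y).val i j = (Pines.distances c₁ A Y).val j i := by
  obtain ⟨U, -, hval⟩ := Pines.distances_val c₁ A Y
  rw [hval, hval]
  simp only [eq_comm (a := i) (b := j), add_comm (U i), mul_comm ((Y i _ : ℝ))]

theorem distances_self (c₁ A : ℝ) (Y : Matrix (Fin n) (Fin n) ℝ) (i : Fin n) :
    (Pines.distances c₁ A Y).val i i = 0 := by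
  obtain ⟨U, -, hval⟩ := Pines.distances_val c₁ A Y
  rw [hval, if_pos rfl]

end Accuracy

/-! ### The rate, and the loss on the event of small noise. -/

theorem sqrt_mul_eq_seriationRate (n : ℕ) (A : ℝ) :
    Real.sqrt n * (A + Real.sqrt A * (n * Real.log n) ^ (1 / 4 : ℝ)) = seriationRate n A := by
  have hn : (0 : ℝ) ≤ n := Nat.cast_nonneg n
  have h : (n : ℝ) ^ (3 / 4 : ℝ) = Real.sqrt n * (n : ℝ) ^ (1 / 4 : ℝ) := by
    rw [Real.sqrt_eq_rpow, ← Real.rpow_add_of_nonneg hn (by norm_num) (by norm_num)]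
    norm_num
  rw [seriationRate, h, Real.mul_rpow hn (Real.log_natCast_nonneg n)]
  ring

/-- The loss of PINES when the noise is under control. -/
theorem NoiseBound.pines_loss_le {n : ℕ} {a A : ℝ} {θ : Fin n → ℝ} {pstar : Equiv.Perm (Fin n)}
    {E : Matrix (Fin n) (Fin n) ℝ}
    (h : NoiseBound a A (Real.sqrt (n * Real.log n)) (permAct pstar (toeplitz θ)) E) (ha : 0 ≤ a)
    (hA : 1 ≤ A) (hθ : Antitone θ) (hθA : ∀ i, θ i ∈ Set.Icc 0 A) (hn : 2 ≤ n)
    (ch : Pines.Choices n) :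
    frobNorm (permAct (Pines.pines (2 * a + 1) (Real.sqrt (20 * a + 4)) A
        (permAct pstar (toeplitz θ) + E) ch).val (permAct pstar (toeplitz θ)) - toeplitz θ) ≤
      110 * Real.sqrt (20 * a + 4) * seriationRate n A := by
  have hA0 : 0 ≤ A := by linarith
  set X := permAct pstar (toeplitz θ) with hX
  set c := Real.sqrt (20 * a + 4) with hc
  set pos : Equiv.Perm (Fin n) := pstar.symm with hpos
  set d := (Pines.distances (2 * a + 1) A (X + E)).val with hd
  set ε := c * (A + Real.sqrt A * (n * Real.log n) ^ (1 / 4 : ℝ)) with hε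
  have hXpos : ∀ i j, X i j = toeplitz θ (pos i) (pos j) := fun i j => rfl
  have hD : ∀ i j, rowDist X i j = rowDist (toeplitz θ) (pos i) (pos j) := fun i j => by
    rw [rowDist_eq_sqrt, rowDist_eq_sqrt,
      ← Equiv.sum_comp pos fun k => (toeplitz θ (pos i) k - toeplitz θ (pos j) k) ^ 2]
    rfl
  have hrow : ∀ (F : ℝ → ℝ) i, ∑ k, F (X i k) = ∑ k, F (toeplitz θ (pos i) k) := fun F i => by
    rw [← Equiv.sum_comp pos fun k => F (toeplitz θ (pos i) k)]
    rfl
  have hser : IsSeriated pos (rowDist X) (Real.sqrt 2) (Real.sqrt 2 * A) := by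
    have := isSeriated_toeplitz hA0 hθ hθA pos
    rwa [show rowDist X = fun i j => rowDist (toeplitz θ) (pos i) (pos j) from
      funext fun i => funext fun j => hD i j]
  have hsq : ∀ i j, |∑ k, X i k ^ 2 - ∑ k, X j k ^ 2| ≤
      2 * A * |∑ k, X i k - ∑ k, X j k| := fun i j => by
    rw [hrow (· ^ 2), hrow (· ^ 2), hrow (fun x => x), hrow (fun x => x)]
    exact toeplitz_abs_sum_sq_sub_le hA0 hθ hθA _ _
  have hstep : ∀ i j, (pos j : ℕ) = pos i + 1 →
      |∑ k, X i k - ∑ k, X j k| ≤ A ∧ rowDist X i j ^ 2 ≤ 2 * A ^ 2 := fun i j hij => by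
    constructor
    · rw [hrow (fun x => x), hrow (fun x => x)]
      exact toeplitz_abs_rowSum_sub_succ_le hA0 hθA hij
    · have := pow_le_pow_left₀ (hser.nonneg i j) (hser.step i j hij) 2
      rwa [mul_pow, Real.sq_sqrt (by norm_num)] at this
  -- The next position serves, or the previous one for the last point; this is why `2 ≤ n` is
  -- required.
  have hnb : ∀ i, ∃ j, j ≠ i ∧ |∑ k, X i k - ∑ k, X j k| ≤ A ∧
      rowDist X i j ^ 2 ≤ 2 * A ^ 2 := by
    intro i
    by_cases hi : (pos i : ℕ) + 1 < n
    · obtain ⟨j, hj⟩ := pos.surjective ⟨pos i + 1, hi⟩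
      have hj' : (pos j : ℕ) = pos i + 1 := by rw [hj]
      exact ⟨j, fun e => by rw [e] at hj'; omega, hstep i j hj'⟩
    · obtain ⟨j, hj⟩ := pos.surjective ⟨pos i - 1, by omega⟩
      have hj' : (pos i : ℕ) = pos j + 1 := by
        rw [hj]
        simp only
        omega
      have := hstep j i hj'
      rw [abs_sub_comm, hser.symm] at this
      exact ⟨j, fun e => by rw [e] at hj'; omega, this⟩
  have hacc : ∀ i j, |d i j - rowDist X i j| ≤ ε := h.distances_accurate ha hA hsq hnb
  have hnl : 0 ≤ n * Real.log n := mul_nonneg (Nat.cast_nonneg n) (Real.log_natCast_nonneg n)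
  have hq0 : 0 ≤ (n * Real.log n) ^ (1 / 4 : ℝ) := Real.rpow_nonneg hnl _
  have hc1 : 1 ≤ c := Real.one_le_sqrt.2 (by linarith)
  have hAε : A ≤ ε := by
    have : 0 ≤ Real.sqrt A * (n * Real.log n) ^ (1 / 4 : ℝ) := by positivity
    nlinarith
  have hε0 : 0 < ε := by linarith
  have h2 : Real.sqrt 2 ^ 2 = 2 := Real.sq_sqrt (by norm_num)
  have h20 : 0 ≤ Real.sqrt 2 := Real.sqrt_nonneg 2
  have h21 : 1 ≤ Real.sqrt 2 := Real.one_le_sqrt.2 (by norm_num)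
  have h22 : Real.sqrt 2 ≤ 3 / 2 := Real.sqrt_le_iff.2 ⟨by norm_num, by norm_num⟩
  obtain ⟨pos', hpos', hord⟩ := Pines.run_spec ch (by omega) hser h21 (by positivity) hε0 hacc
    (distances_self _ _ _) (distances_comm _ _ _) rfl
  have hval : (Pines.pines (2 * a + 1) c A (X + E) ch).val = (Pines.run ch d
      (Real.sqrt 2 ^ 2 * (Real.sqrt 2 * A) +
        (2 * Real.sqrt 2 ^ 2 + 3 * Real.sqrt 2 + 2) * ε)
      (Real.sqrt 2 * (Real.sqrt 2 * A) + 2 * (1 + Real.sqrt 2) * ε)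
      (Real.sqrt 2 * A + ε)).val := rfl
  rw [← hval] at hord
  set p := (Pines.pines (2 * a + 1) c A (X + E) ch).val with hp
  set κ := (1 + Real.sqrt 2) * (Real.sqrt 2 ^ 2 * (Real.sqrt 2 * A) +
    (2 * Real.sqrt 2 ^ 2 + 3 * Real.sqrt 2 + 2) * ε + ε) with hκ
  have hκ0 : 0 ≤ κ := by positivity
  -- Since `A ≤ ε`, the term in `δ` is absorbed into `ε`. The factor `55`, doubled by the Frobenius
  -- bound, becomes `110`.
  have hκle : Real.sqrt 2 * κ ≤ 55 * ε := by
    have e1 : Real.sqrt 2 * A ≤ 3 / 2 * ε := mul_le_mul h22 hAε hA0 (by norm_num)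
    have e2 : Real.sqrt 2 * ε ≤ 3 / 2 * ε := mul_le_mul_of_nonneg_right h22 hε0.le
    have e3 : Real.sqrt 2 * κ = (Real.sqrt 2 + 2) * (2 * (Real.sqrt 2 * A) +
        (7 * ε + 3 * (Real.sqrt 2 * ε))) := by
      rw [hκ, h2]
      linear_combination (2 * (Real.sqrt 2 * A) + (7 * ε + 3 * (Real.sqrt 2 * ε))) * h2
    rw [e3]
    calc _ ≤ (3 / 2 + 2) * (2 * (3 / 2 * ε) + (7 * ε + 3 * (3 / 2 * ε))) := by
          gcongr
      _ ≤ _ := by linarith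
  have hser' : IsSeriated pos' (rowDist X) (Real.sqrt 2) (Real.sqrt 2 * A) := by
    rcases hpos' with rfl | rfl
    exacts [hser, hser.rev]
  have hXpos' : ∀ i j, X i j = toeplitz θ (pos' i) (pos' j) := by
    rcases hpos' with rfl | rfl
    · exact hXpos
    · intro i j
      simp only [Equiv.trans_apply, Fin.revPerm_apply, toeplitz_rev, hXpos]
  have hdisp := fun i => (hser'.displacement h20 hκ0 hord i).trans hκle
  refine (frobNorm_permAct_sub_le hXpos' (toeplitz_comm θ) (by positivity) hdisp).trans_eq ?_
  rw [← sqrt_mul_eq_seriationRate, hε]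
  ring

/-! ## The theorem -/

theorem frobNorm_permAct_sub_toeplitz_le {n : ℕ} {A : ℝ} (hA : 0 ≤ A) {θ : Fin n → ℝ}
    (hθA : ∀ i, θ i ∈ Set.Icc 0 A) (p : Equiv.Perm (Fin n)) :
    frobNorm (permAct p (toeplitz θ) - toeplitz θ) ≤ A * n := by
  refine Real.sqrt_le_iff.2 ⟨by positivity, ?_⟩
  have : ∀ i j, (permAct p (toeplitz θ) - toeplitz θ) i j ^ 2 ≤ A ^ 2 := by
    intro i j
    have h1 : toeplitz θ (p.symm i) (p.symm j) ∈ Set.Icc 0 A := hθA _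
    have h2 : toeplitz θ i j ∈ Set.Icc 0 A := hθA _
    exact sq_le_sq' (by simp [permAct]; linarith [h1.1, h2.2])
      (by simp [permAct]; linarith [h1.2, h2.1])
  refine (Finset.sum_le_sum fun i _ => Finset.sum_le_sum fun j _ => this i j).trans_eq ?_
  simp
  ring

theorem permAct_mul {n : ℕ} (p q : Equiv.Perm (Fin n)) (M : Matrix (Fin n) (Fin n) ℝ) :
    permAct (p * q) M = permAct p (permAct q M) := rfl

/-- The pair `p, 1` is admissible as soon as `p` is nontrivial, the reversal being its own inverse.
-/
theorem sepDist_le {n : ℕ} {𝒯 : Set (Matrix (Fin n) (Fin n) ℝ)} {Θ : Matrix (Fin n) (Fin n) ℝ}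
    (hΘ : Θ ∈ 𝒯) {p : Equiv.Perm (Fin n)} (h1 : p ≠ 1) (h2 : p ≠ Fin.revPerm) :
    sepDist 𝒯 Set.univ ≤ ENNReal.ofReal (frobNorm (permAct p Θ - Θ)) := by
  have hne : p⁻¹ * 1 ≠ 1 ∧ p⁻¹ * 1 ≠ Fin.revPerm := by
    rw [mul_one]
    refine ⟨fun h => h1 (inv_eq_one.1 h), fun h => h2 ?_⟩
    rw [← inv_inv p, h]
    exact Fin.revPerm_symm
  exact (iInf₂_le Θ hΘ).trans ((iInf₂_le p (Set.mem_univ _)).trans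
    ((iInf₂_le 1 (Set.mem_univ _)).trans (iInf_le _ hne)))

theorem permAct_toeplitz_of_trivial {n : ℕ} {p : Equiv.Perm (Fin n)}
    (h : p = 1 ∨ p = Fin.revPerm) (θ : Fin n → ℝ) : permAct p (toeplitz θ) = toeplitz θ := by
  rcases h with rfl | rfl
  · rfl
  · ext i j
    exact toeplitz_rev θ i j

theorem measure_pines_loss_ge_le {Ω : Type*} [MeasurableSpace Ω] {P : Measure Ω}
    [IsProbabilityMeasure P] {n : ℕ} (hn : 1 ≤ n) {A : ℝ} (hA : 1 ≤ A) {θ : Fin n → ℝ}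
    (hθA : ∀ i, θ i ∈ Set.Icc 0 A) (hθ : Antitone θ) (pstar : Equiv.Perm (Fin n))
    {E : Ω → Matrix (Fin n) (Fin n) ℝ} (hm : ∀ i j, Measurable fun ω => E ω i j)
    (hind : iIndepFun (fun (e : Fin n × Fin n) (ω : Ω) => E ω e.1 e.2) P)
    (hE : ∀ i j, HasSubgaussianMGF (fun ω => E ω i j) 1 P) {δ : ℝ} (hδ : 0 < δ) {a : ℝ}
    (ha : a = 2 * gaussianExpSq + 6) :
    P {ω | ∃ ch : Pines.Choices n,
      (110 * Real.sqrt (20 * a + 4) + 7) / δ * seriationRate n A ≤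
        frobNorm (permAct
            (Pines.pines (2 * a + 1) (Real.sqrt (20 * a + 4)) A
              (permAct pstar (toeplitz θ) + E ω) ch).val
            (permAct pstar (toeplitz θ)) - toeplitz θ)} ≤ ENNReal.ofReal δ := by
  have ha0 : 0 ≤ a := by linarith [one_le_gaussianExpSq]
  have hA0 : 0 ≤ A := by linarith
  have hn1 : (1 : ℝ) ≤ n := by exact_mod_cast hn
  have hn0 : (0 : ℝ) < n := by linarith
  have hs0 : 0 < Real.sqrt n := Real.sqrt_pos.2 hn0
  have hs2 : Real.sqrt n * Real.sqrt n = n := Real.mul_self_sqrt hn0.le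
  set c := Real.sqrt (20 * a + 4) with hc
  have hc0 : 0 ≤ c := Real.sqrt_nonneg _
  have hrate : A * Real.sqrt n ≤ seriationRate n A := by
    have : 0 ≤ Real.sqrt A * (n : ℝ) ^ (3 / 4 : ℝ) * Real.log n ^ (1 / 4 : ℝ) :=
      mul_nonneg (by positivity) (Real.rpow_nonneg (Real.log_natCast_nonneg n) _)
    rw [seriationRate]
    linarith
  have hrate0 : 0 < seriationRate n A := lt_of_lt_of_le (by positivity) hrate
  rcases le_or_gt 1 δ with hδ1 | hδ1
  · exact prob_le_one.trans (ENNReal.one_le_ofReal.2 hδ1)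
  -- If `δ √n ≤ 6`, the trivial bound satisfies `A n ≤ 6 A √n / δ`, which the summand `7` in the
  -- constant covers. Otherwise `√n > 6` because `δ < 1`, and the failure probability `6 / n` is
  -- below `δ`.
  rcases le_or_gt (δ * Real.sqrt n) 6 with hsmall | hlarge
  · have hempty : ∀ p : Equiv.Perm (Fin n),
        frobNorm (permAct p (permAct pstar (toeplitz θ)) - toeplitz θ) <
          (110 * c + 7) / δ * seriationRate n A := fun p => by
      refine (frobNorm_permAct_sub_toeplitz_le hA0 hθA (p * pstar)).trans_lt ?_
      rw [div_mul_eq_mul_div, lt_div_iff₀ hδ]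
      calc A * n * δ = A * Real.sqrt n * (δ * Real.sqrt n) := by
            linear_combination (-(A * δ)) * hs2
        _ ≤ A * Real.sqrt n * 6 := by gcongr
        _ ≤ seriationRate n A * 6 := by gcongr
        _ < (110 * c + 7) * seriationRate n A := by nlinarith
    refine (measure_mono_null (fun ω hω => ?_) measure_empty).trans_le zero_le
    obtain ⟨ch, hch⟩ := hω
    exact absurd hch (not_le.2 (hempty _))
  · have hn6 : 6 < Real.sqrt n := by nlinarith
    have hn2 : 2 ≤ n := by
      by_contra hcon
      have h1 : n = 1 := by omega
      rw [h1] at hn6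
      norm_num at hn6
    have hX : ∀ i j, |permAct pstar (toeplitz θ) i j| ≤ A := fun i j => by
      have h1 : permAct pstar (toeplitz θ) i j ∈ Set.Icc 0 A := hθA _
      rw [abs_of_nonneg h1.1]
      exact h1.2
    refine (measure_mono fun ω hω => ?_).trans
      ((measure_not_noiseBound_le (by omega) hm hind hE (by linarith) hX).trans
        (ENNReal.ofReal_le_ofReal ?_))
    · intro hnoise
      obtain ⟨ch, hch⟩ := hω
      rw [← ha] at hnoise
      have h1 := hnoise.pines_loss_le ha0 hA hθ hθA hn2 ch
      have h2 : 110 * c * seriationRate n A < (110 * c + 7) / δ * seriationRate n A := by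
        refine mul_lt_mul_of_pos_right ?_ hrate0
        rw [lt_div_iff₀ hδ]
        nlinarith
      linarith
    · rw [div_le_iff₀ hn0, ← hs2]
      nlinarith

theorem mainTheorem12 :
    ∃ c₁ c₂ C : ℝ, 0 < c₁ ∧ 0 < c₂ ∧ 0 < C ∧
      -- the procedure runs in polynomial time, on every input and for all its arbitrary choices
      (∃ K k : ℕ, ∀ (n : ℕ) (A : ℝ) (Y : Matrix (Fin n) (Fin n) ℝ) (ch : Pines.Choices n),
        (Pines.pines c₁ c₂ A Y ch).steps ≤ K * (n + 1) ^ k) ∧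
      ∀ (Ω : Type*) [MeasurableSpace Ω] (P : Measure Ω) [IsProbabilityMeasure P]
        (n : ℕ), 1 ≤ n → ∀ A : ℝ, 1 ≤ A →
        ∀ θ : Fin n → ℝ, (∀ i, θ i ∈ Set.Icc 0 A) → Antitone θ →
        ∀ (pstar : Equiv.Perm (Fin n)) (E : Ω → Matrix (Fin n) (Fin n) ℝ),
        (∀ i j, Measurable fun ω => E ω i j) →
        iIndepFun (fun (e : Fin n × Fin n) (ω : Ω) => E ω e.1 e.2) P →
        (∀ i j, ∫ ω, E ω i j ∂P = 0) →
        (∀ i j, HasSubgaussianMGF (fun ω => E ω i j) 1 P) →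
        ∀ δ : ℝ, 0 < δ →
          -- for every class, the loss is small with probability at least `1 - δ`
          P {ω | ∃ ch : Pines.Choices n,
              C / δ * seriationRate n A ≤
                frobNorm (permAct
                    (Pines.pines c₁ c₂ A (permAct pstar (toeplitz θ) + E ω) ch).val
                    (permAct pstar (toeplitz θ)) - toeplitz θ)} ≤ ENNReal.ofReal δ ∧
          -- for a separated class, recovery is perfect with probability at least `1 - δ`
          ∀ 𝒯 : Set (Matrix (Fin n) (Fin n) ℝ), 𝒯 ⊆ robinsonToeplitz n →
            ENNReal.ofReal (C / δ * seriationRate n A) ≤ sepDist 𝒯 Set.univ →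
            toeplitz θ ∈ 𝒯 →
            P {ω | ∃ ch : Pines.Choices n,
              ¬ (permAct (Pines.pines c₁ c₂ A (permAct pstar (toeplitz θ) + E ω) ch).val
                    (permAct pstar (toeplitz θ)) = toeplitz θ ∧
                ((Pines.pines c₁ c₂ A (permAct pstar (toeplitz θ) + E ω) ch).val * pstar = 1 ∨
                  (Pines.pines c₁ c₂ A (permAct pstar (toeplitz θ) + E ω) ch).val * pstar =
                    Fin.revPerm))} ≤ ENNReal.ofReal δ := by
  have hK := one_le_gaussianExpSq
  obtain ⟨a, ha⟩ : ∃ a, a = 2 * gaussianExpSq + 6 := ⟨_, rfl⟩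
  refine ⟨2 * a + 1, Real.sqrt (20 * a + 4), 110 * Real.sqrt (20 * a + 4) + 7, by linarith,
    Real.sqrt_pos.2 (by linarith), by positivity,
    ⟨200, 5, fun n A Y ch => Pines.pines_steps_le _ _ _ _ _⟩, ?_⟩
  intro Ω _ P _ n hn A hA θ hθA hθ pstar E hm hind _ hE δ hδ
  have hloss := measure_pines_loss_ge_le hn hA hθA hθ pstar hm hind hE hδ ha
  -- Failure of recovery for a choice implies a large loss for the same choice, so monotonicity of
  -- `P` suffices and neither event has to be measurable.
  refine ⟨hloss, fun 𝒯 _ hsep hmem => (measure_mono fun ω hω => ?_).trans hloss⟩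
  obtain ⟨ch, hch⟩ := hω
  refine ⟨ch, ?_⟩
  by_contra hlt
  rw [not_le] at hlt
  refine hch ?_
  generalize (Pines.pines (2 * a + 1) (Real.sqrt (20 * a + 4)) A
    (permAct pstar (toeplitz θ) + E ω) ch).val = p at hlt
  rw [← permAct_mul] at hlt ⊢
  have htriv : p * pstar = 1 ∨ p * pstar = Fin.revPerm := by
    by_contra hcon
    rw [not_or] at hcon
    exact hlt.not_ge ((ENNReal.ofReal_le_ofReal_iff (q := frobNorm _) (Real.sqrt_nonneg _)).1
      (hsep.trans (sepDist_le hmem hcon.1 hcon.2)))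
  exact ⟨permAct_toeplitz_of_trivial htriv θ, htriv⟩
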